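/- **Setting.** Let $\Omega$ be a set of $n\ge 1$ arms with known costs $c:\Omega\to\mathbb{R}_{>0}$, let $B$ be a budget with $c(v)\le B$ for all $v$ and $B\le\sum_{v\in\Omega}c(v)$, and let $c(S)=\sum_{v\in S}c(v)$. The permitted actions are the sets $S\subseteq\Omega$ with $c(S)\le B$. Put $q=B/c_{\min}$ with $c_{\min}=\min_v c(v)$, and let $\tilde K$ be an upper bound on the cardinality of the permitted sets (for example $\tilde K=\min\{n,q\}$, or the maximal cardinality itself). There are $m'$ agents and $1\le m\le m'$. If agent $i$ plays $S$ at time $t$, it receives a reward $f_{i,t}(S)\in[0,1]$; the random functions $f_{i,t}$ are independent over all $(i,t)$, for every $S$ the rewards $f_{i,t}(S)$ are identically distributed, and their mean $f(S)=\mathbb{E}[f_{i,t}(S)]$ is a monotone submodular set function on $2^\Omega$. Let $S^\star$ maximize $f$ over the permitted sets. **PartialEnumeration** (with a value oracle): query all permitted sets with one or two arms; for every permitted set $U$ with three arms, query $U$, put $A=U$, and, as long as some arm $e\notin A$ has $c(A\cup\{e\})\le B$, query $A\cup\{e\}$ for all such $e$ and add to $A$ one that maximizes $(\bar f(A\cup\{e\})-\bar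 f(A))/c(e)$, where $\bar f$ denotes the reported values; output the candidate (one- or two-arm set, or completed set) with the largest reported value, or $\emptyset$ if there is none. **C-MA-MAB** with horizon $T$, run with PartialEnumeration and the parameters $\beta=\gamma=0$, $\psi=n^5$, $\delta=4+2\tilde K+2q$: let $r=\left\lceil m^{-1}\left(\delta\sqrt{\log T}\,\tfrac{Tm}{n^5}\right)^{2/3}\right\rceil$. Whenever the subroutine queries an action $A$ (one communication round), all agents play $A$ for $r$ consecutive time steps, a set of $m$ agents is selected at random, independently of the rewards, and the average of the empirical means of the selected agents over these $r$ steps is returned to the subroutine. When the subroutine has stopped with output $\Theta$, all agents play $\Theta$ at all remaining times. If the exploration is not finished at time $T$, the process simply stops at time $T$. Let $S_{i,t}$ be the action of agent $i$ at time $t$ and $$\mathcal{R}_i(T)=\sum_{t=1}^{T}\Big(\big(1-\tfrac1e\big)f_{i,t}(S^\star)-f_{i,t}(S_{i,t})\Big).$$ **Statement.** There is an absolute constant $C>0$ such that in every such setting: 1. the number of communication rounds is always at most $C\,n^5$ (in particular it is $\tilde{\mathcal O}(n^5)$), and every action that is played is permitted; 2. if $T\ge 2$ and $T\ge n^5m$,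 then for every agent $i$ the regret $\mathcal{R}_i(T)$ is integrable and $$\mathbb{E}[\mathcal{R}_i(T)]\le C\,m^{-1/3}\,\tilde K^{2/3}\,q^{2/3}\,n^{5/3}\,T^{2/3}\,(\log T)^{1/3},$$ that is, the expected $(1-1/e)$-regret is $\tilde{\mathcal O}\left(m^{-1/3}\tilde K^{2/3}q^{2/3}n^{5/3}T^{2/3}\right)$. -/

import Mathlib

open MeasureTheory ProbabilityTheory

/-! ### Algorithms with access to a value oracle -/

/-- An algorithm that adaptively asks for real values of actions in `𝒮` and ends with a result
in `α`: it either stops, or asks for the value of an action and continues with the answer.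
Answers may be noisy, so asking twice for the same action may give two different answers. -/
inductive QueryAlg (𝒮 : Type) (α : Type) : Type
  | output (a : α) : QueryAlg 𝒮 α
  | query (A : 𝒮) (next : ℝ → QueryAlg 𝒮 α) : QueryAlg 𝒮 α

namespace QueryAlg

/-- Sequential composition. -/
def bind {𝒮 α β : Type} : QueryAlg 𝒮 α → (α → QueryAlg 𝒮 β) → QueryAlg 𝒮 β
  | output a, g => g a
  | query A next, g => query A fun v => bind (next v) g

/-- Run one algorithm for each member of a list, in order, and collect the results. -/
def collect {𝒮 ι α : Type} : List ι → (ι → QueryAlg 𝒮 α) → QueryAlg 𝒮 (List α)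
  | [], _ => output []
  | x :: l, g => bind (g x) fun a => bind (collect l g) fun as => output (a :: as)

/-- Query the action `g x` for each member `x` of a list, and return the pairs of `x` and the
reported value of `g x`. -/
def evaluate {𝒮 ι : Type} (l : List ι) (g : ι → 𝒮) : QueryAlg 𝒮 (List (ι × ℝ)) :=
  collect l fun x => query (g x) fun v => output (x, v)

/-- Run an algorithm when the `j`-th query (for the action `A`) is answered by `est j A`; the
numbering of the queries starts at the last argument. The result is the list of the queried
actions, in order, and the final result. -/
def run {𝒮 α : Type} (est : ℕ → 𝒮 → ℝ) : QueryAlg 𝒮 α → ℕ → List 𝒮 × α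
  | output a, _ => ([], a)
  | query A next, j =>
      (A :: (run est (next (est j A)) (j + 1)).1, (run est (next (est j A)) (j + 1)).2)

end QueryAlg

/-! ### Submodular maximization under a knapsack constraint -/

/-- Diminishing returns. -/
def IsSubmodular {n : ℕ} (f : Finset (Fin n) → ℝ) : Prop :=
  ∀ A B : Finset (Fin n), A ⊆ B → ∀ v, v ∉ B →
    f (insert v B) - f B ≤ f (insert v A) - f A

/-- The cost of a set of arms. -/
def cost {n : ℕ} (c : Fin n → ℝ) (S : Finset (Fin n)) : ℝ := ∑ v ∈ S, c v

/-- The permitted actions: the sets of arms whose cost is within the budget. -/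
def Feasible {n : ℕ} (c : Fin n → ℝ) (B : ℝ) (S : Finset (Fin n)) : Prop := cost c S ≤ B

/-- `S` is an optimal permitted action for `f`. -/
def IsOptimal {n : ℕ} (c : Fin n → ℝ) (B : ℝ) (f : Finset (Fin n) → ℝ)
    (S : Finset (Fin n)) : Prop :=
  Feasible c B S ∧ ∀ S', Feasible c B S' → f S' ≤ f S

/-- `q = B / c_min`. -/
noncomputable def budgetRatio {n : ℕ} (c : Fin n → ℝ) (B : ℝ) : ℝ := B / ⨅ v, c v

namespace PartialEnumeration

/-- The arms that can be added to `A` within the budget. -/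
noncomputable def extensions {n : ℕ} (c : Fin n → ℝ) (B : ℝ) (A : Finset (Fin n)) :
    List (Fin n) :=
  open Classical in
  (List.finRange n).filter fun e => decide (e ∉ A ∧ Feasible c B (insert e A))

/-- The density greedy completion of `A`, whose reported value is `v`: as long as some arm fits
into the budget, query `A ∪ {e}` for all arms `e` that fit, add an arm `e` that maximizes the
reported marginal density `(f̄ (A ∪ {e}) - f̄ A) / c e`, and repeat. The first argument bounds
the number of additions (`n` is always enough). Returned are the final set and its reported
value. -/
noncomputable def greedy {n : ℕ} (c : Fin n → ℝ) (B : ℝ) :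
    ℕ → Finset (Fin n) → ℝ → QueryAlg (Finset (Fin n)) (Finset (Fin n) × ℝ)
  | 0, A, v => .output (A, v)
  | k + 1, A, v =>
      (QueryAlg.evaluate (extensions c B A) fun e => insert e A).bind fun L =>
        match L.argmax fun p => (p.2 - v) / c p.1 with
        | none => .output (A, v)
        | some p => greedy c B k (insert p.1 A) p.2

/-- The feasible sets with exactly `k` arms. -/
noncomputable def feasibleOfCard {n : ℕ} (c : Fin n → ℝ) (B : ℝ) (k : ℕ) :
    List (Finset (Fin n)) :=
  open Classical in
  ((Finset.univ : Finset (Finset (Fin n))).filter fun S => S.card = k ∧ Feasible c B S).toList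

end PartialEnumeration

open PartialEnumeration in
/-- Partial enumeration: query all feasible sets with one or two arms, complete every feasible
set with three arms by the density greedy rule, and output the candidate with the largest
reported value. -/
noncomputable def partialEnumeration {n : ℕ} (c : Fin n → ℝ) (B : ℝ) :
    QueryAlg (Finset (Fin n)) (Finset (Fin n)) :=
  (QueryAlg.evaluate (feasibleOfCard c B 1 ++ feasibleOfCard c B 2) id).bind fun small =>
    (QueryAlg.collect (feasibleOfCard c B 3) fun U =>
        .query U fun v => greedy c B n U v).bind fun large =>
      match (small ++ large).argmax fun p => p.2 with
      | none => .output ∅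
      | some p => .output p.1

/-! ### The offline-to-online multi-agent framework C-MA-MAB -/

/-- The parameters `β, γ, ψ, δ` of a resilient approximation algorithm that the framework uses. -/
structure ResilienceParams where
  β : ℝ
  γ : ℝ
  ψ : ℝ
  δ : ℝ

namespace CMAMAB

/-- `r_i^⋆`, the number of times that each agent plays a queried action. -/
noncomputable def reps (p : ResilienceParams) (m T : ℕ) : ℕ :=
  ⌈(m : ℝ)⁻¹ * (p.δ * √(Real.log T) * (T * m / p.ψ) ^ (1 / (p.β + 1)))
      ^ ((2 + 2 * p.β) / (3 + p.β))⌉₊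

/-- `ε^⋆`, the accuracy with which the offline algorithm is run. -/
noncomputable def eps (p : ResilienceParams) (m T : ℕ) : ℝ :=
  open Classical in
  if 0 < p.β ∨ 0 < p.γ then (p.ψ * reps p m T / T) ^ (1 / (p.β + 1)) else 0

/-- The server's estimate for the action `A` of the `j`-th query, when `sel j` is the set of
selected agents and `F i t S` is the reward of agent `i` at time `t` for action `S`: each agent
plays `A` at the times `j * r, …, j * r + r - 1`, and the server averages the local means of the
selected agents. -/
noncomputable def serverMean {M : ℕ} {𝒮 : Type} (r : ℕ) (F : Fin M → ℕ → 𝒮 → ℝ)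
    (sel : ℕ → Finset (Fin M)) (j : ℕ) (A : 𝒮) : ℝ :=
  (∑ i ∈ sel j, (∑ s ∈ Finset.range r, F i (j * r + s) A) / (r : ℝ)) / ((sel j).card : ℝ)

/-- The queries of the offline algorithm `𝒜 ε^⋆` inside C-MA-MAB, and its final output `Θ`. -/
noncomputable def trace {M : ℕ} {𝒮 : Type} (p : ResilienceParams) (𝒜 : ℝ → QueryAlg 𝒮 𝒮)
    (m T : ℕ) (F : Fin M → ℕ → 𝒮 → ℝ) (sel : ℕ → Finset (Fin M)) : List 𝒮 × 𝒮 :=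
  (𝒜 (eps p m T)).run (serverMean (reps p m T) F sel) 0

/-- The number of communication rounds: one for each query. -/
noncomputable def commRounds {M : ℕ} {𝒮 : Type} (p : ResilienceParams)
    (𝒜 : ℝ → QueryAlg 𝒮 𝒮) (m T : ℕ) (F : Fin M → ℕ → 𝒮 → ℝ)
    (sel : ℕ → Finset (Fin M)) : ℕ :=
  (trace p 𝒜 m T F sel).1.length

/-- The action that is played at time `t` (the same for all agents): during exploration every
queried action is played `r_i^⋆` times in a row, afterwards `Θ` is played. -/
noncomputable def play {M : ℕ} {𝒮 : Type} (p : ResilienceParams) (𝒜 : ℝ → QueryAlg 𝒮 𝒮)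
    (m T : ℕ) (F : Fin M → ℕ → 𝒮 → ℝ) (sel : ℕ → Finset (Fin M)) (t : ℕ) : 𝒮 :=
  if t < commRounds p 𝒜 m T F sel * reps p m T then
    (trace p 𝒜 m T F sel).1.getD (t / reps p m T) (trace p 𝒜 m T F sel).2
  else (trace p 𝒜 m T F sel).2

/-- The cumulative `α`-regret of agent `i` over the times `0, …, T - 1`, against `Sopt`. -/
noncomputable def regret {M : ℕ} {𝒮 : Type} (p : ResilienceParams) (𝒜 : ℝ → QueryAlg 𝒮 𝒮)
    (m T : ℕ) (α : ℝ) (Sopt : 𝒮) (F : Fin M → ℕ → 𝒮 → ℝ) (sel : ℕ → Finset (Fin M))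
    (i : Fin M) : ℝ :=
  ∑ t ∈ Finset.range T, (α * F i t Sopt - F i t (play p 𝒜 m T F sel t))

end CMAMAB

/-- The stochastic environment. `F ω i t S` is the reward in `[0,1]` that agent `i` gets at time
`t` if it plays `S`. The reward functions of different agents and times are independent, for every
action the rewards are identically distributed, and `f` is their mean. -/
structure IsRewardModel {n M : ℕ} {Ω : Type*} [MeasurableSpace Ω] (P : Measure Ω)
    (F : Ω → Fin M → ℕ → Finset (Fin n) → ℝ) (f : Finset (Fin n) → ℝ) : Prop where
  measurable : ∀ i t S, Measurable fun ω => F ω i t S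
  mem_Icc : ∀ ω i t S, F ω i t S ∈ Set.Icc (0 : ℝ) 1
  indep : iIndepFun (fun (x : Fin M × ℕ) ω => F ω x.1 x.2) P
  identDistrib : ∀ S i t i' t',
    IdentDistrib (fun ω => F ω i t S) (fun ω => F ω i' t' S) P P
  mean : ∀ S i t, ∫ ω, F ω i t S ∂P = f S

/-- `sel ω j` is the random set of the `m` agents that communicate in round `j`; the selections
are made independently of the rewards. -/
structure IsSelection {n M : ℕ} {Ω : Type*} [MeasurableSpace Ω] (P : Measure Ω) (m : ℕ)
    (F : Ω → Fin M → ℕ → Finset (Fin n) → ℝ) (sel : Ω → ℕ → Finset (Fin M)) : Prop where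
  measurable : ∀ j, Measurable fun ω => sel ω j
  card_eq : ∀ ω j, (sel ω j).card = m
  indep : IndepFun sel F P

/-!
The proof has three independent parts.

*Approximation.* Suppose that every reported value is within `ε` of the true one. If the optimum
`S` has one or two arms, it is a candidate itself, and if it is empty, every set is as good.
Otherwise let `U` be the three arms that the greedy rule without costs would pick from `S`
(`exists_three_greedy`), and follow the density greedy completion of `U`. As long as the densest
remaining arm of `S` fits, submodularity bounds the gap `f S - f A` by `B - c(U)` times the density
of the chosen arm, so the gap decays exponentially in the cost spent; inaccurate values add an
error of at most `2 ε (K + q)` in total, where `K` bounds the cardinality of feasible sets and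
`q = B / c_min` (`GreedyGap.step`). When the densest remaining arm does not fit, adding it would
reach the factor `1 - 1 / e` (`GreedyGap.of_not_feasible`), and by the choice of `U` leaving it out
costs at most `f U / 3 ≤ f U / e`. Altogether the output is worth at least
`(1 - 1 / e) f S - (2 + 2 K + 2 q) ε` (`PartialEnumeration.partialEnumeration_meets_approx`).

*Concentration.* For a fixed action, a round averages `m r` independent rewards, so Hoeffding's
inequality applies (`IsRewardModel.measure_serverMean_le`). The queried action is random, but it is
determined by earlier rounds and hence independent of the rewards of its own round; thus a union
bound over the at most `4 n ^ 5` rounds suffices, without a factor for the number of actions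
(`measure_inaccurate_le`). In the same way the output is independent of the rewards after
exploration, so playing it yields its mean (`integral_reward_output`). All this is done for a fixed
sequence of selections; since the selections are independent of the rewards, Fubini's theorem gives
the random case (`integral_regret_le_of_forall`). Measurability of the runs holds because they
depend on the reported values only through finitely many comparisons
(`PartialEnumeration.measurableSet_run`).

*Balance.* Exploration costs at most `4 n ^ 5 r`, and with accuracy `√(log T / (m r))` the remaining
steps cost at most `T δ √(log T / (m r))` plus a constant multiple of `n ^ 5`. The choice of `r`
balances both terms (`balance_exploration`).
-/

/-! ### Reasoning about query algorithms -/

namespace QueryAlg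

variable {𝒮 ι α β : Type}

/-- `Meets V ok b Q g` says that `g` only asks for actions that satisfy `ok`, asks at most `b`
times, and ends with a result that satisfies `Q`, whenever each answer `v` for an action `A`
satisfies `V A v`. -/
def Meets (V : 𝒮 → ℝ → Prop) (ok : 𝒮 → Prop) : ℕ → (α → Prop) → QueryAlg 𝒮 α → Prop
  | _, Q, output a => Q a
  | 0, _, query _ _ => False
  | b + 1, Q, query A next => ok A ∧ ∀ v, V A v → Meets V ok b Q (next v)

section Meets

variable {V : 𝒮 → ℝ → Prop} {ok : 𝒮 → Prop}

theorem meets_output {b : ℕ} {Q : α → Prop} {a : α} (h : Q a) :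
    Meets V ok b Q (output a) := by
  cases b <;> exact h

theorem Meets.mono {b b' : ℕ} (hb : b ≤ b') {Q Q' : α → Prop} (hQ : ∀ a, Q a → Q' a)
    {g : QueryAlg 𝒮 α} (h : Meets V ok b Q g) : Meets V ok b' Q' g := by
  induction g generalizing b b' with
  | output a => exact meets_output (hQ a (by cases b <;> exact h))
  | query A next ih =>
    obtain _ | b := b
    · exact h.elim
    obtain _ | b' := b'
    · omega
    exact ⟨h.1, fun v hv => ih v (by omega) (h.2 v hv)⟩

theorem Meets.bind {b b' : ℕ} {Q : α → Prop} {Q' : β → Prop} {g : QueryAlg 𝒮 α}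
    {h : α → QueryAlg 𝒮 β} (hg : Meets V ok b Q g) (hh : ∀ a, Q a → Meets V ok b' Q' (h a)) :
    Meets V ok (b + b') Q' (g.bind h) := by
  induction g generalizing b with
  | output a => exact (hh a (by cases b <;> exact hg)).mono (by omega) fun _ => id
  | query A next ih =>
    obtain _ | b := b
    · exact hg.elim
    rw [Nat.add_right_comm]
    exact ⟨hg.1, fun v hv => ih v (hg.2 v hv)⟩

theorem Meets.collect {b : ℕ} {Q : ι → α → Prop} {g : ι → QueryAlg 𝒮 α} (l : List ι)
    (hg : ∀ x ∈ l, Meets V ok b (Q x) (g x)) :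
    Meets V ok (l.length * b) (List.Forall₂ Q l) (collect l g) := by
  induction l with
  | nil => exact meets_output List.Forall₂.nil
  | cons x l ih =>
    have h := (hg x (by simp)).bind (b' := l.length * b + 0)
      (Q' := List.Forall₂ Q (x :: l))
      (h := fun a => (QueryAlg.collect l g).bind fun as => output (a :: as))
      fun a ha => (ih fun y hy => hg y (by simp [hy])).bind fun as has =>
        meets_output (List.Forall₂.cons ha has)
    exact h.mono (by simp [List.length_cons, Nat.succ_mul]; omega) fun _ => id

theorem Meets.evaluate (l : List ι) (g : ι → 𝒮) (hg : ∀ x ∈ l, ok (g x)) :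
    Meets V ok l.length (List.Forall₂ (fun x p => p.1 = x ∧ V (g x) p.2) l)
      (evaluate l g) := by
  have := Meets.collect (V := V) (ok := ok) (b := 1)
    (Q := fun x (p : ι × ℝ) => p.1 = x ∧ V (g x) p.2)
    (g := fun x => query (g x) fun v => output (x, v)) l
    fun x hx => ⟨hg x hx, fun v hv => ⟨rfl, hv⟩⟩
  simpa [QueryAlg.evaluate] using this

theorem Meets.run {est : ℕ → 𝒮 → ℝ} (hest : ∀ j A, V A (est j A)) {b : ℕ} {Q : α → Prop}
    {g : QueryAlg 𝒮 α} (h : Meets V ok b Q g) (j : ℕ) :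
    (∀ A ∈ (run est g j).1, ok A) ∧ (run est g j).1.length ≤ b ∧ Q (run est g j).2 := by
  induction g generalizing b j with
  | output a => exact ⟨by simp [QueryAlg.run], by simp [QueryAlg.run], by cases b <;> exact h⟩
  | query A next ih =>
    obtain _ | b := b
    · exact h.elim
    obtain ⟨h1, h2, h3⟩ := ih _ (h.2 _ (hest j A)) (j + 1)
    refine ⟨?_, by simpa [QueryAlg.run] using h2, h3⟩
    simpa [QueryAlg.run] using ⟨h.1, h1⟩

theorem Meets.and {b b' : ℕ} {Q Q' : α → Prop} {g : QueryAlg 𝒮 α} (h : Meets V ok b Q g)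
    (h' : Meets V ok b' Q' g) : Meets V ok b (fun a => Q a ∧ Q' a) g := by
  induction g generalizing b b' with
  | output a => exact meets_output ⟨by cases b <;> exact h, by cases b' <;> exact h'⟩
  | query A next ih =>
    obtain _ | b := b
    · exact h.elim
    obtain _ | b' := b'
    · exact h'.elim
    exact ⟨h.1, fun v hv => ih v (h.2 v hv) (h'.2 v hv)⟩

end Meets

/-- `Rel R Q g g'` says that `g` and `g'` ask for the same actions and end with `Q`-related
results, whenever they receive `R`-related answers. -/
def Rel (R : ℝ → ℝ → Prop) (Q : α → β → Prop) : QueryAlg 𝒮 α → QueryAlg 𝒮 β → Prop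
  | output a, output b => Q a b
  | query A next, query A' next' => A = A' ∧ ∀ v v', R v v' → Rel R Q (next v) (next' v')
  | _, _ => False

section Rel

variable {R : ℝ → ℝ → Prop} {α' β' : Type}

theorem Rel.bind {Q : α → α' → Prop} {Q' : β → β' → Prop} {g : QueryAlg 𝒮 α}
    {g' : QueryAlg 𝒮 α'} {h : α → QueryAlg 𝒮 β} {h' : α' → QueryAlg 𝒮 β'}
    (hg : Rel R Q g g') (hh : ∀ a a', Q a a' → Rel R Q' (h a) (h' a')) :
    Rel R Q' (g.bind h) (g'.bind h') := by
  induction g generalizing g' with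
  | output a =>
    cases g' with
    | output a' => exact hh a a' hg
    | query A' next' => exact hg.elim
  | query A next ih =>
    cases g' with
    | output a' => exact hg.elim
    | query A' next' => exact ⟨hg.1, fun v v' hv => ih v (hg.2 v v' hv)⟩

theorem Rel.collect {Q : α → α' → Prop} {g : ι → QueryAlg 𝒮 α} {g' : ι → QueryAlg 𝒮 α'}
    (hg : ∀ x, Rel R Q (g x) (g' x)) (l : List ι) :
    Rel R (List.Forall₂ Q) (collect l g) (collect l g') := by
  induction l with
  | nil => exact List.Forall₂.nil
  | cons x l ih =>
    exact (hg x).bind fun a a' ha => ih.bind fun as as' has => List.Forall₂.cons ha has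

theorem Rel.evaluate (l : List ι) (g : ι → 𝒮) :
    Rel R (List.Forall₂ fun p p' : ι × ℝ => p.1 = p'.1 ∧ R p.2 p'.2)
      (evaluate l g) (evaluate l g) :=
  Rel.collect (Q := fun p p' : ι × ℝ => p.1 = p'.1 ∧ R p.2 p'.2)
    (g := fun x => query (g x) fun v => output (x, v))
    (g' := fun x => query (g x) fun v => output (x, v))
    (fun _ => ⟨rfl, fun _ _ hv => ⟨rfl, hv⟩⟩) l

theorem Rel.run {Q : α → α' → Prop} {est est' : ℕ → 𝒮 → ℝ}
    (hest : ∀ j A, R (est j A) (est' j A)) {g : QueryAlg 𝒮 α} {g' : QueryAlg 𝒮 α'}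
    (h : Rel R Q g g') (j : ℕ) :
    (run est g j).1 = (run est' g' j).1 ∧ Q (run est g j).2 (run est' g' j).2 := by
  induction g generalizing g' j with
  | output a =>
    cases g' with
    | output a' => exact ⟨rfl, h⟩
    | query A' next' => exact h.elim
  | query A next ih =>
    cases g' with
    | output a' => exact h.elim
    | query A' next' =>
      obtain ⟨rfl, h⟩ := h
      obtain ⟨h1, h2⟩ := ih _ (h _ _ (hest j A)) (j + 1)
      exact ⟨by simp [QueryAlg.run, h1], h2⟩

end Rel

/-- A run depends only on the answers to the queries that it makes. -/
theorem run_congr_of_queried {est est' : ℕ → 𝒮 → ℝ} (g : QueryAlg 𝒮 α) (j : ℕ)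
    (h : ∀ i A, (run est g j).1[i]? = some A → est (j + i) A = est' (j + i) A) :
    run est g j = run est' g j := by
  induction g generalizing j with
  | output a => rfl
  | query A next ih =>
    have h0 : est j A = est' j A := h 0 A (by simp [run])
    have := ih (est j A) (j + 1) fun i A' hi => by
      have := h (i + 1) A' (by simpa [run] using hi)
      rwa [show j + (i + 1) = j + 1 + i by omega] at this
    simp only [run]
    rw [← h0, this]

/-- The action of a query depends only on the answers in earlier rounds. -/
theorem getElem?_run_congr {est est' : ℕ → 𝒮 → ℝ} (g : QueryAlg 𝒮 α) (j k : ℕ)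
    (h : ∀ i, i < j + k → est i = est' i) :
    (run est g j).1[k]? = (run est' g j).1[k]? := by
  induction g generalizing j k with
  | output a => rfl
  | query A next ih =>
    obtain _ | k := k
    · simp [run]
    · simpa [run, h j (by omega)] using ih (est' j A) (j + 1) k fun i hi => h i (by omega)

end QueryAlg

/-- The maximizer of a list is preserved by a relation that respects the order of the values. -/
theorem List.Forall₂.argmax_rel {α α' : Type} {R : α → α' → Prop} {f : α → ℝ} {f' : α' → ℝ}
    (hf : ∀ a a' b b', R a a' → R b b' → (f a < f b ↔ f' a' < f' b'))
    {l : List α} {l' : List α'} (h : List.Forall₂ R l l') :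
    Option.Rel R (l.argmax f) (l'.argmax f') := by
  unfold List.argmax
  refine List.rel_foldl (P := Option.Rel R) (R := R) ?_ Option.Rel.none h
  intro o o' ho b b' hb
  cases ho with
  | none => exact Option.Rel.some hb
  | @some a a' ha =>
    simp only [List.argAux, hf _ _ _ _ ha hb]
    split_ifs
    · exact Option.Rel.some hb
    · exact Option.Rel.some ha

/-! ### Submodular functions and density greedy steps -/

section Submodular

variable {n : ℕ} {c : Fin n → ℝ} {B : ℝ} {f : Finset (Fin n) → ℝ}

theorem Feasible.mono {S S' : Finset (Fin n)} (hc : ∀ v, 0 < c v) (h : S ⊆ S')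
    (hS : Feasible c B S') : Feasible c B S :=
  (Finset.sum_le_sum_of_subset_of_nonneg h fun v _ _ => (hc v).le).trans hS

theorem cost_insert {A : Finset (Fin n)} {e : Fin n} (he : e ∉ A) :
    cost c (insert e A) = c e + cost c A := Finset.sum_insert he

theorem cost_le_cost {S S' : Finset (Fin n)} (hc : ∀ v, 0 < c v) (h : S ⊆ S') :
    cost c S ≤ cost c S' :=
  Finset.sum_le_sum_of_subset_of_nonneg h fun v _ _ => (hc v).le

theorem IsSubmodular.union_sub_le (hf : IsSubmodular f) (A D : Finset (Fin n))
    (hD : Disjoint D A) : f (A ∪ D) - f A ≤ ∑ o ∈ D, (f (insert o A) - f A) := by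
  induction D using Finset.induction_on with
  | empty => simp
  | insert o D ho ih =>
    rw [Finset.disjoint_insert_left] at hD
    have h1 := hf A (A ∪ D) Finset.subset_union_left o (by simp [ho, hD.1])
    have h2 := ih hD.2
    rw [Finset.sum_insert ho, Finset.union_insert]
    linarith

/-- If `o` has the largest marginal density with respect to `A` among the elements of `S \ A`,
then the gap between `f S` and `f A` is at most the cost of `S \ A` times that density. -/
theorem sub_le_mul_density (hc : ∀ v, 0 < c v) (hmono : Monotone f) (hsub : IsSubmodular f)
    {S A : Finset (Fin n)} {o : Fin n} {b : ℝ} (hb : cost c (S \ A) ≤ b)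
    (ho : ∀ x ∈ S \ A, (f (insert x A) - f A) / c x ≤ (f (insert o A) - f A) / c o) :
    f S - f A ≤ b * ((f (insert o A) - f A) / c o) := by
  have h1 := hsub.union_sub_le A (S \ A) Finset.sdiff_disjoint
  have h2 : f S ≤ f (A ∪ S \ A) := hmono (by intro x hx; by_cases h : x ∈ A <;> simp [h, hx])
  have h3 : ∑ x ∈ S \ A, (f (insert x A) - f A)
      ≤ ∑ x ∈ S \ A, c x * ((f (insert o A) - f A) / c o) :=
    Finset.sum_le_sum fun x hx => by
      have := ho x hx
      rw [div_le_iff₀ (hc x)] at this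
      linarith
  rw [← Finset.sum_mul] at h3
  have h4 : 0 ≤ (f (insert o A) - f A) / c o :=
    div_nonneg (sub_nonneg.2 (hmono (Finset.subset_insert o A))) (hc o).le
  have := mul_le_mul_of_nonneg_right hb h4
  unfold cost at this
  linarith

/-- The gap between `f S` and `f A` is at most what `ε`-accurate density greedy steps from `U`
to `A` guarantee: exponential decay in the cost spent, plus `2 ε` per step and `2 ε` per `κ`
of cost spent. -/
def GreedyGap (c : Fin n → ℝ) (B : ℝ) (f : Finset (Fin n) → ℝ) (ε κ : ℝ)
    (S U A : Finset (Fin n)) : Prop :=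
  f S - f A ≤ Real.exp (-((cost c A - cost c U) / (B - cost c U))) * (f S - f U)
    + 2 * ε * ((A.card : ℝ) - U.card) + 2 * ε * ((cost c A - cost c U) / κ)

theorem GreedyGap.refl {ε κ : ℝ} (S U : Finset (Fin n)) : GreedyGap c B f ε κ S U U := by
  simp [GreedyGap]

/-- A greedy step with `ε`-accurate values preserves the bound, provided that the best remaining
element `o` of `S` competes with the chosen element `e`. -/
theorem GreedyGap.step (hc : ∀ v, 0 < c v) (hmono : Monotone f) (hsub : IsSubmodular f)
    {ε κ : ℝ} (hε : 0 ≤ ε) (hκ : 0 < κ) (hκc : ∀ v, κ ≤ c v) {S U A : Finset (Fin n)}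
    (hS : Feasible c B S) (hUS : U ⊆ S) (hUA : U ⊆ A) (h : GreedyGap c B f ε κ S U A)
    {o e : Fin n} (he : e ∉ A) (heB : Feasible c B (insert e A))
    (ho : ∀ x ∈ S \ A, (f (insert x A) - f A) / c x ≤ (f (insert o A) - f A) / c o)
    {v vo ve : ℝ} (hv : |v - f A| ≤ ε) (hvo : |vo - f (insert o A)| ≤ ε)
    (hve : |ve - f (insert e A)| ≤ ε) (hle : (vo - v) / c o ≤ (ve - v) / c e) :
    GreedyGap c B f ε κ S U (insert e A) := by
  have hce := hc e
  have hco := hc o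
  have hAU := cost_le_cost hc hUA
  have heB' : c e + cost c A ≤ B := by rw [← cost_insert he]; exact heB
  have hb : 0 < B - cost c U := by linarith
  have hSU : cost c (S \ A) ≤ B - cost c U := by
    have h1 : cost c (S \ U) + cost c U = cost c S := Finset.sum_sdiff hUS
    have h2 := cost_le_cost hc (Finset.sdiff_subset_sdiff (Finset.Subset.refl S) hUA)
    have h3 : cost c S ≤ B := hS
    linarith
  have hgap := sub_le_mul_density hc hmono hsub hSU ho
  set ρ := (f (insert o A) - f A) / c o with hρ
  have hdo : f (insert o A) - f A = c o * ρ := by rw [hρ]; field_simp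
  -- the accuracy of the three values turns the noisy comparison into an exact one
  have hgreedy : c e * ρ ≤ f (insert e A) - f A + 2 * ε + 2 * ε * (c e / κ) := by
    rw [div_le_iff₀ hco] at hle
    rw [abs_le] at hv hvo hve
    have h1 : c o * ρ - ε - (v - f A) ≤ (ve - v) / c e * c o := by linarith
    have h2 : c e * (c o * ρ - ε - (v - f A)) ≤ (ve - v) * c o := by
      calc _ ≤ c e * ((ve - v) / c e * c o) := mul_le_mul_of_nonneg_left h1 hce.le
        _ = _ := by field_simp
    have h3 : (ve - v) * c o ≤ (f (insert e A) - f A + 2 * ε) * c o :=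
      mul_le_mul_of_nonneg_right (by linarith) hco.le
    have h4 : c e * (ε + (v - f A)) ≤ c e * (2 * ε) :=
      mul_le_mul_of_nonneg_left (by linarith) hce.le
    have h5 : c e * (2 * ε) ≤ 2 * ε * (c e / κ) * c o := by
      have : 2 * ε * c e * 1 ≤ 2 * ε * c e * (c o / κ) :=
        mul_le_mul_of_nonneg_left ((one_le_div hκ).2 (hκc o)) (by positivity)
      calc c e * (2 * ε) = 2 * ε * c e * 1 := by ring
        _ ≤ _ := this
        _ = _ := by ring
    refine le_of_mul_le_mul_right ?_ hco
    linarith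
  unfold GreedyGap at h ⊢
  rw [cost_insert he, Finset.card_insert_of_notMem he]
  set b := B - cost c U
  set W := cost c A - cost c U
  have hW : c e + cost c A - cost c U = W + c e := by ring
  rw [hW]
  set t := c e / b with ht
  have ht0 : 0 ≤ t := by positivity
  have ht1 : t ≤ 1 := by rw [ht, div_le_one hb]; simp only [b]; linarith
  have hρt : t * (f S - f A) ≤ c e * ρ := by
    calc t * (f S - f A) ≤ t * (b * ρ) := mul_le_mul_of_nonneg_left hgap ht0
      _ = c e * ρ := by rw [ht]; field_simp
  have hG0 : 0 ≤ f S - f U := sub_nonneg.2 (hmono hUS)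
  have hexp : (1 - t) * Real.exp (-(W / b)) ≤ Real.exp (-((W + c e) / b)) := by
    rw [add_div, neg_add, Real.exp_add, mul_comm]
    exact mul_le_mul_of_nonneg_left (Real.one_sub_le_exp_neg t) (Real.exp_pos _).le
  have hcard : 0 ≤ (A.card : ℝ) - U.card := by
    rw [sub_nonneg]; exact_mod_cast Finset.card_le_card hUA
  have hW0 : 0 ≤ W := by simp only [W]; linarith
  set err := 2 * ε * ((A.card : ℝ) - U.card) + 2 * ε * (W / κ) with herr
  have herr0 : 0 ≤ err := by positivity
  have h1 : (1 - t) * (f S - f A) ≤ (1 - t) * (Real.exp (-(W / b)) * (f S - f U) + err) :=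
    mul_le_mul_of_nonneg_left (by rw [herr]; linarith) (by linarith)
  have h2 := mul_le_mul_of_nonneg_right hexp hG0
  have h3 : 0 ≤ t * err := by positivity
  have h4 : 2 * ε * ((W + c e) / κ) = 2 * ε * (W / κ) + 2 * ε * (c e / κ) := by ring
  rw [h4]
  push_cast
  linarith

/-- If the best remaining element of `S` does not fit into the budget any more, then adding it
would reach the factor `1 - 1 / e`, up to the accumulated error. -/
theorem GreedyGap.of_not_feasible (hc : ∀ v, 0 < c v) (hmono : Monotone f) (hsub : IsSubmodular f)
    {ε κ : ℝ} {S U A : Finset (Fin n)}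
    (hS : Feasible c B S) (hUS : U ⊆ S) (hUA : U ⊆ A) (h : GreedyGap c B f ε κ S U A)
    (hε : 0 ≤ ε) (hκ : 0 < κ)
    {o : Fin n} (hoA : o ∈ S \ A) (hoB : ¬ Feasible c B (insert o A))
    (ho : ∀ x ∈ S \ A, (f (insert x A) - f A) / c x ≤ (f (insert o A) - f A) / c o) :
    f S - f (insert o A) ≤ Real.exp (-1) * (f S - f U)
      + 2 * ε * ((A.card : ℝ) - U.card) + 2 * ε * ((cost c A - cost c U) / κ) := by
  rw [Finset.mem_sdiff] at hoA
  have hco := hc o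
  have hAU := cost_le_cost hc hUA
  have hoB' : B < c o + cost c A := by rw [← cost_insert hoA.2]; exact not_le.1 hoB
  have hS' : cost c S ≤ B := hS
  have hoU : c o ≤ B - cost c U := by
    have h1 : cost c (insert o U) ≤ cost c S :=
      cost_le_cost hc (Finset.insert_subset hoA.1 hUS)
    rw [cost_insert fun h => hoA.2 (hUA h)] at h1
    linarith
  have hSU : cost c (S \ A) ≤ B - cost c U := by
    have h1 : cost c (S \ U) + cost c U = cost c S := Finset.sum_sdiff hUS
    have h2 := cost_le_cost hc (Finset.sdiff_subset_sdiff (Finset.Subset.refl S) hUA)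
    linarith
  have hgap := sub_le_mul_density hc hmono hsub hSU ho
  unfold GreedyGap at h
  set b := B - cost c U with hbdef
  have hb : 0 < b := by linarith
  set W := cost c A - cost c U with hWdef
  set t := c o / b with ht
  have ht0 : 0 ≤ t := by positivity
  have ht1 : t ≤ 1 := by rw [ht, div_le_one hb]; exact hoU
  have hρt : t * (f S - f A) ≤ f (insert o A) - f A := by
    calc _ ≤ t * (b * ((f (insert o A) - f A) / c o)) := mul_le_mul_of_nonneg_left hgap ht0
      _ = _ := by rw [ht]; field_simp
  have hG0 : 0 ≤ f S - f U := sub_nonneg.2 (hmono hUS)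
  have hexp : (1 - t) * Real.exp (-(W / b)) ≤ Real.exp (-1) := by
    calc (1 - t) * Real.exp (-(W / b)) ≤ Real.exp (-t) * Real.exp (-(W / b)) :=
          mul_le_mul_of_nonneg_right (Real.one_sub_le_exp_neg t) (Real.exp_pos _).le
      _ = Real.exp (-((W + c o) / b)) := by rw [← Real.exp_add, ht]; congr 1; ring
      _ ≤ Real.exp (-1) := by
          rw [Real.exp_le_exp, neg_le_neg_iff, one_le_div hb]
          linarith
  have hcard : 0 ≤ (A.card : ℝ) - U.card := by
    rw [sub_nonneg]; exact_mod_cast Finset.card_le_card hUA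
  have hW0 : 0 ≤ W := by linarith
  set err := 2 * ε * ((A.card : ℝ) - U.card) + 2 * ε * (W / κ) with herr
  have herr0 : 0 ≤ err := by positivity
  have h1 : (1 - t) * (f S - f A) ≤ (1 - t) * (Real.exp (-(W / b)) * (f S - f U) + err) :=
    mul_le_mul_of_nonneg_left (by rw [herr]; linarith) (by linarith)
  have h2 := mul_le_mul_of_nonneg_right hexp hG0
  have h3 : 0 ≤ t * err := by positivity
  linarith

/-- The first three elements that the greedy rule without costs picks from `S`: every further
element of `S` has a marginal value of at most a third of the value of these three. -/
theorem exists_three_greedy (hsub : IsSubmodular f) {S : Finset (Fin n)}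
    (hS : 3 ≤ S.card) :
    ∃ U ⊆ S, U.card = 3 ∧ ∀ A, U ⊆ A → ∀ o ∈ S \ A,
      3 * (f (insert o A) - f A) ≤ f U - f ∅ := by
  obtain ⟨u, huS, hu⟩ := S.exists_max_image (fun x => f {x})
    (Finset.card_pos.1 (by omega))
  have hcu : (S.erase u).card = S.card - 1 := Finset.card_erase_of_mem huS
  obtain ⟨v, hvS, hv⟩ := (S.erase u).exists_max_image (fun x => f (insert x {u}))
    (Finset.card_pos.1 (by omega))
  have hcv : ((S.erase u).erase v).card = S.card - 1 - 1 := by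
    rw [Finset.card_erase_of_mem hvS, hcu]
  obtain ⟨w, hwS, hw⟩ := ((S.erase u).erase v).exists_max_image
    (fun x => f (insert x (insert v {u}))) (Finset.card_pos.1 (by omega))
  simp only [Finset.mem_erase] at hv hw hvS hwS
  refine ⟨insert w (insert v {u}), ?_, ?_, ?_⟩
  · intro x hx
    simp only [Finset.mem_insert, Finset.mem_singleton] at hx
    rcases hx with rfl | rfl | rfl
    exacts [hwS.2.2, hvS.2, huS]
  · rw [Finset.card_insert_of_notMem (by simp [hwS.1, hwS.2.1]),
      Finset.card_insert_of_notMem (by simp [hvS.1])]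
    simp
  · intro A hA o ho
    rw [Finset.mem_sdiff] at ho
    have huA : u ∈ A := hA (by simp)
    have hvA : v ∈ A := hA (by simp)
    have hou : o ≠ u := fun h => ho.2 (h ▸ huA)
    have hov : o ≠ v := fun h => ho.2 (h ▸ hvA)
    have s0 := hsub ∅ A (by simp) o ho.2
    have s1 := hsub {u} A (by simpa using huA) o ho.2
    have s2 := hsub (insert v {u}) A (by
      intro x hx; exact hA (Finset.mem_insert_of_mem hx)) o ho.2
    have m0 := hu o ho.1
    have m1 := hv o ⟨hou, ho.1⟩
    have m2 := hw o ⟨hov, hou, ho.1⟩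
    simp only [insert_empty_eq] at s0
    linarith

end Submodular

/-! ### Partial enumeration with inexact values -/

theorem List.Forall₂.exists_of_mem_right {α β : Type} {R : α → β → Prop} {l : List α}
    {l' : List β} (h : List.Forall₂ R l l') {b : β} (hb : b ∈ l') : ∃ a ∈ l, R a b := by
  induction h with
  | nil => simp at hb
  | cons h _ ih =>
    rcases List.mem_cons.1 hb with rfl | hb
    · exact ⟨_, by simp, h⟩
    · obtain ⟨a, ha, hab⟩ := ih hb
      exact ⟨a, by simp [ha], hab⟩

theorem List.Forall₂.exists_of_mem_left {α β : Type} {R : α → β → Prop} {l : List α}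
    {l' : List β} (h : List.Forall₂ R l l') {a : α} (ha : a ∈ l) : ∃ b ∈ l', R a b :=
  h.flip.exists_of_mem_right ha

namespace PartialEnumeration

open QueryAlg

variable {n : ℕ} {c : Fin n → ℝ} {B : ℝ} {f : Finset (Fin n) → ℝ}

theorem mem_extensions {A : Finset (Fin n)} {e : Fin n} :
    e ∈ extensions c B A ↔ e ∉ A ∧ Feasible c B (insert e A) := by
  classical
  simp [extensions]

theorem length_extensions_le (A : Finset (Fin n)) : (extensions c B A).length ≤ n := by
  classical
  exact (List.length_filter_le _ _).trans (by simp)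

theorem mem_feasibleOfCard {k : ℕ} {S : Finset (Fin n)} :
    S ∈ feasibleOfCard c B k ↔ S.card = k ∧ Feasible c B S := by
  classical
  simp [feasibleOfCard]

theorem length_feasibleOfCard_le (k : ℕ) : (feasibleOfCard c B k).length ≤ n ^ k := by
  classical
  unfold feasibleOfCard
  rw [Finset.length_toList]
  calc _ ≤ (Finset.powersetCard k (Finset.univ : Finset (Fin n))).card :=
        Finset.card_le_card fun S hS => by
          simp only [Finset.mem_filter] at hS
          simp [Finset.mem_powersetCard, hS.2.1]
    _ = n.choose k := by simp
    _ ≤ n ^ k := Nat.choose_le_pow n k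

/-- The greedy completion stays feasible, only adds arms, and carries a reported value of its
final set. -/
theorem greedy_meets {V : Finset (Fin n) → ℝ → Prop} (k : ℕ) (A : Finset (Fin n)) (v : ℝ)
    (hA : Feasible c B A) (hv : V A v) :
    Meets V (Feasible c B) (k * n) (fun p => A ⊆ p.1 ∧ Feasible c B p.1 ∧ V p.1 p.2)
      (greedy c B k A v) := by
  induction k generalizing A v with
  | zero => exact meets_output ⟨Finset.Subset.refl A, hA, hv⟩
  | succ k ih =>
    have h1 := (Meets.evaluate (V := V) (ok := Feasible c B) (extensions c B A)
      (fun e => insert e A) fun x hx => (mem_extensions.1 hx).2).mono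
        (length_extensions_le A) fun _ => id
    rw [Nat.succ_mul, Nat.add_comm]
    refine h1.bind fun L hL => ?_
    cases hp : L.argmax fun p => (p.2 - v) / c p.1 with
    | none => exact meets_output ⟨Finset.Subset.refl A, hA, hv⟩
    | some p =>
      obtain ⟨x, hx, rfl, hxv⟩ := hL.exists_of_mem_right (List.argmax_mem hp)
      exact (ih _ _ (mem_extensions.1 hx).2 hxv).mono le_rfl fun q hq =>
        ⟨(Finset.subset_insert _ _).trans hq.1, hq.2⟩

theorem approx_of_subset (hmono : Monotone f) (hf0 : 0 ≤ f ∅) {ε κ Kt : ℝ} (hε : 0 ≤ ε)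
    (hκ : 0 < κ) (hB : 0 ≤ B) (hKt : 0 ≤ Kt) {S A : Finset (Fin n)} (hSA : S ⊆ A) :
    (1 - 1 / Real.exp 1) * f S - (2 * Kt + 2 * (B / κ)) * ε ≤ f A := by
  have h1 := hmono hSA
  have h2 : 0 ≤ 1 / Real.exp 1 * f S :=
    mul_nonneg (by positivity) (hf0.trans (hmono (Finset.empty_subset S)))
  have h3 : 0 ≤ (2 * Kt + 2 * (B / κ)) * ε := by positivity
  linarith

/-- With `ε`-accurate values, the greedy completion of the first three greedy elements `U` of
the feasible set `S` reaches the factor `1 - 1 / e` of `f S` up to an error. The induction runs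
over the current set `A`; the fuel `k` suffices as long as `n ≤ k + A.card`. -/
theorem greedy_meets_approx (hc : ∀ v, 0 < c v) (hmono : Monotone f) (hsub : IsSubmodular f)
    (hf0 : 0 ≤ f ∅) {ε κ Kt : ℝ} (hε : 0 ≤ ε) (hκ : 0 < κ) (hκc : ∀ v, κ ≤ c v)
    (hKt : ∀ S, Feasible c B S → (S.card : ℝ) ≤ Kt) {S U : Finset (Fin n)}
    (hS : Feasible c B S) (hUS : U ⊆ S)
    (hU : ∀ A, U ⊆ A → ∀ o ∈ S \ A, 3 * (f (insert o A) - f A) ≤ f U - f ∅)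
    (k : ℕ) (A : Finset (Fin n)) (v : ℝ) (hk : n ≤ k + A.card)
    (hA : Feasible c B A) (hUA : U ⊆ A) (hv : |v - f A| ≤ ε)
    (hgap : GreedyGap c B f ε κ S U A) :
    Meets (fun A v => |v - f A| ≤ ε) (Feasible c B) (k * n)
      (fun p =>
        (1 - 1 / Real.exp 1) * f S - (2 * Kt + 2 * (B / κ)) * ε ≤ f p.1)
      (greedy c B k A v) := by
  have hB : 0 ≤ B := le_trans (Finset.sum_nonneg fun v _ => (hc v).le) hA
  have hKt0 : 0 ≤ Kt := le_trans (Nat.cast_nonneg _) (hKt A hA)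
  induction k generalizing A v with
  | zero =>
    have hAu : A = Finset.univ := by
      rw [← Finset.card_eq_iff_eq_univ, Fintype.card_fin]
      have := Finset.card_le_univ A
      rw [Fintype.card_fin] at this
      omega
    exact meets_output (approx_of_subset hmono hf0 hε hκ hB hKt0
      (hAu ▸ Finset.subset_univ S))
  | succ k ih =>
    -- either nothing of `S` is left, or its best remaining element does not fit,
    -- or the greedy rule continues
    by_cases hSA : S ⊆ A
    · exact (greedy_meets (k + 1) A v hA hv).mono le_rfl fun p hp =>
        approx_of_subset hmono hf0 hε hκ hB hKt0 (hSA.trans hp.1)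
    obtain ⟨o, hoA, ho⟩ := (S \ A).exists_max_image
      (fun x => (f (insert x A) - f A) / c x) (Finset.sdiff_nonempty.2 hSA)
    by_cases hoB : Feasible c B (insert o A)
    · have h1 := (Meets.evaluate (V := fun A v => |v - f A| ≤ ε) (ok := Feasible c B)
        (extensions c B A) (fun e => insert e A) fun x hx => (mem_extensions.1 hx).2).mono
          (length_extensions_le A) fun _ => id
      rw [Nat.succ_mul, Nat.add_comm]
      refine h1.bind fun L hL => ?_
      obtain ⟨po, hpoL, hpo1, hpo2⟩ := hL.exists_of_mem_left
        (mem_extensions.2 ⟨(Finset.mem_sdiff.1 hoA).2, hoB⟩)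
      cases hp : L.argmax fun p => (p.2 - v) / c p.1 with
      | none =>
        rw [List.argmax_eq_none] at hp
        simp [hp] at hpoL
      | some p =>
        obtain ⟨x, hx, rfl, hxv⟩ := hL.exists_of_mem_right (List.argmax_mem hp)
        have hle := List.le_of_mem_argmax hpoL hp
        simp only [hpo1] at hle
        obtain ⟨hx1, hx2⟩ := mem_extensions.1 hx
        exact ih _ _ (by rw [Finset.card_insert_of_notMem hx1]; omega) hx2
          (hUA.trans (Finset.subset_insert _ _)) hxv
          (hgap.step hc hmono hsub hε hκ hκc hS hUS hUA hx1 hx2 ho hv hpo2 hxv hle)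
    · refine (greedy_meets (k + 1) A v hA hv).mono le_rfl fun p hp => ?_
      have h1 := hgap.of_not_feasible hc hmono hsub hS hUS hUA hε hκ hoA hoB ho
      have h2 := hU A hUA o hoA
      have h3 := hmono hp.1
      have hf0' : 0 ≤ f U := hf0.trans (hmono (Finset.empty_subset U))
      have h4 : (A.card : ℝ) - U.card ≤ Kt := by
        have := hKt A hA
        have : (0 : ℝ) ≤ U.card := Nat.cast_nonneg _
        linarith
      have h5 : (cost c A - cost c U) / κ ≤ B / κ := by
        refine div_le_div_of_nonneg_right ?_ hκ.le
        have h3 : cost c A ≤ B := hA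
        have : 0 ≤ cost c U := Finset.sum_nonneg fun v _ => (hc v).le
        linarith
      have h4' := mul_le_mul_of_nonneg_left h4 hε
      have h5' := mul_le_mul_of_nonneg_left h5 hε
      -- the missing element is worth at most a third of `f U`, and `1 / 3 ≤ 1 / e`
      have h6 : 1 / 3 * f U ≤ 1 / Real.exp 1 * f U :=
        mul_le_mul_of_nonneg_right
          (one_div_le_one_div_of_le (Real.exp_pos 1) Real.exp_one_lt_three.le) hf0'
      rw [Real.exp_neg, ← one_div] at h1
      linarith

/-- Whatever the answers are, partial enumeration asks at most `4 n ^ 5` queries, all of them for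
feasible sets, and its result is feasible. -/
theorem partialEnumeration_meets (hn : 1 ≤ n) (V : Finset (Fin n) → ℝ → Prop) (hB : 0 ≤ B) :
    Meets V (Feasible c B) (4 * n ^ 5) (Feasible c B) (partialEnumeration c B) := by
  have h1 := Meets.evaluate (V := V) (ok := Feasible c B)
    (feasibleOfCard c B 1 ++ feasibleOfCard c B 2) id (by
      intro S hS
      rcases List.mem_append.1 hS with h | h <;> exact (mem_feasibleOfCard.1 h).2)
  have h2 := Meets.collect (V := V) (ok := Feasible c B) (b := n * n + 1)
    (Q := fun _ (p : Finset (Fin n) × ℝ) => Feasible c B p.1)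
    (g := fun U => .query U fun v => greedy c B n U v) (feasibleOfCard c B 3) (by
      intro U hU
      have hU := (mem_feasibleOfCard.1 hU).2
      exact ⟨hU, fun v hv => (greedy_meets n U v hU hv).mono le_rfl fun p hp => hp.2.1⟩)
  have hlen : (feasibleOfCard c B 1 ++ feasibleOfCard c B 2).length
      + ((feasibleOfCard c B 3).length * (n * n + 1) + 0) ≤ 4 * n ^ 5 := by
    have e1 := length_feasibleOfCard_le (c := c) (B := B) 1
    have e2 := length_feasibleOfCard_le (c := c) (B := B) 2
    have e3 := Nat.mul_le_mul_right (n * n + 1) (length_feasibleOfCard_le (c := c) (B := B) 3)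
    have p1 : n ^ 1 ≤ n ^ 5 := Nat.pow_le_pow_right hn (by norm_num)
    have p2 : n ^ 2 ≤ n ^ 5 := Nat.pow_le_pow_right hn (by norm_num)
    have p3 : n ^ 3 ≤ n ^ 5 := Nat.pow_le_pow_right hn (by norm_num)
    have : n ^ 3 * (n * n + 1) = n ^ 5 + n ^ 3 := by ring
    rw [List.length_append]
    omega
  refine (h1.bind fun small hs => h2.bind fun large hl => ?_).mono hlen fun _ => id
  cases hp : (small ++ large).argmax fun p => p.2 with
  | none => exact meets_output (by simpa [Feasible, cost] using hB)
  | some p =>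
    refine meets_output ?_
    rcases List.mem_append.1 (List.argmax_mem hp) with h | h
    · obtain ⟨x, hx, rfl, -⟩ := hs.exists_of_mem_right h
      rcases List.mem_append.1 hx with h | h <;> exact (mem_feasibleOfCard.1 h).2
    · obtain ⟨x, hx, h⟩ := hl.exists_of_mem_right h
      exact h

/-- With `ε`-accurate values, partial enumeration finds a set whose value is at least
`1 - 1 / e` times the optimum, up to an error that is linear in `ε`. -/
theorem partialEnumeration_meets_approx (hn : 1 ≤ n) (hc : ∀ v, 0 < c v) (hcB : ∀ v, c v ≤ B)
    (hmono : Monotone f) (hsub : IsSubmodular f)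
    (hf0 : 0 ≤ f ∅) {ε κ Kt : ℝ} (hε : 0 ≤ ε) (hκ : 0 < κ) (hκc : ∀ v, κ ≤ c v)
    (hKt : ∀ S, Feasible c B S → (S.card : ℝ) ≤ Kt) {S : Finset (Fin n)}
    (hS : Feasible c B S) :
    ∃ b, Meets (fun A v => |v - f A| ≤ ε) (Feasible c B) b
      (fun R => (1 - 1 / Real.exp 1) * f S - (2 + 2 * Kt + 2 * (B / κ)) * ε ≤ f R)
      (partialEnumeration c B) := by
  have hB : 0 ≤ B := (hc ⟨0, hn⟩).le.trans (hcB _)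
  have hKt0 : 0 ≤ Kt := by simpa using hKt ∅ (by simpa [Feasible, cost] using hB)
  have herr : 0 ≤ (2 * Kt + 2 * (B / κ)) * ε := by positivity
  set V : Finset (Fin n) → ℝ → Prop := fun A v => |v - f A| ≤ ε with hV
  set small := feasibleOfCard c B 1 ++ feasibleOfCard c B 2 with hsmall
  set bound := (1 - 1 / Real.exp 1) * f S - (2 * Kt + 2 * (B / κ)) * ε with hbound
  have hSbound : ∀ R, f S ≤ f R → bound ≤ f R := by
    intro R hR
    have : 0 ≤ 1 / Real.exp 1 * f S :=
      mul_nonneg (by positivity) (hf0.trans (hmono (Finset.empty_subset S)))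
    linarith
  -- a candidate that is good enough: a small set, or the completion of a certain triple
  have hcand : (∃ R ∈ small, bound ≤ f R) ∨ ∃ U ∈ feasibleOfCard c B 3,
      ∀ v, V U v → Meets V (Feasible c B) (n * n) (fun p => bound ≤ f p.1)
        (greedy c B n U v) := by
    by_cases h3 : 3 ≤ S.card
    · obtain ⟨U, hUS, hU3, hU⟩ := exists_three_greedy hsub h3
      have hUB : Feasible c B U := hS.mono hc hUS
      exact Or.inr ⟨U, mem_feasibleOfCard.2 ⟨hU3, hUB⟩, fun v hv =>
        greedy_meets_approx hc hmono hsub hf0 hε hκ hκc hKt hS hUS hU n U v (by omega) hUB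
          (Finset.Subset.refl U) hv (GreedyGap.refl S U)⟩
    · left
      rcases (show S.card = 0 ∨ S.card = 1 ∨ S.card = 2 by omega) with h | h | h
      · have : S = ∅ := Finset.card_eq_zero.1 h
        exact ⟨{⟨0, hn⟩}, List.mem_append_left _ (mem_feasibleOfCard.2
          ⟨by simp, by simpa [Feasible, cost] using hcB _⟩),
          hSbound _ (hmono (by simp [this]))⟩
      · exact ⟨S, List.mem_append_left _ (mem_feasibleOfCard.2 ⟨h, hS⟩), hSbound _ le_rfl⟩
      · exact ⟨S, List.mem_append_right _ (mem_feasibleOfCard.2 ⟨h, hS⟩), hSbound _ le_rfl⟩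
  have h1 := Meets.evaluate (V := V) (ok := Feasible c B) small id (by
      intro S hS
      rcases List.mem_append.1 hS with h | h <;> exact (mem_feasibleOfCard.1 h).2)
  have h2 := Meets.collect (V := V) (ok := Feasible c B) (b := n * n + 1)
    (Q := fun U (p : Finset (Fin n) × ℝ) => V p.1 p.2 ∧
      ((∀ v, V U v → Meets V (Feasible c B) (n * n) (fun p => bound ≤ f p.1)
        (greedy c B n U v)) → bound ≤ f p.1))
    (g := fun U => .query U fun v => greedy c B n U v) (feasibleOfCard c B 3) (by
      intro U hU
      have hUB := (mem_feasibleOfCard.1 hU).2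
      refine ⟨hUB, fun v hv => ?_⟩
      by_cases hgood : ∀ v, V U v → Meets V (Feasible c B) (n * n) (fun p => bound ≤ f p.1)
        (greedy c B n U v)
      · exact ((greedy_meets n U v hUB hv).and (hgood v hv)).mono le_rfl fun p hp =>
          ⟨hp.1.2.2, fun _ => hp.2⟩
      · exact (greedy_meets n U v hUB hv).mono le_rfl fun p hp =>
          ⟨hp.2.2, fun h => (hgood h).elim⟩)
  refine ⟨_, h1.bind fun Ls hs => h2.bind (b' := 0) fun Ll hl => ?_⟩
  obtain ⟨q, hqL, hqV, hq⟩ : ∃ q ∈ Ls ++ Ll, V q.1 q.2 ∧ bound ≤ f q.1 := by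
    rcases hcand with ⟨R, hR, hRb⟩ | ⟨U, hU, hUb⟩
    · obtain ⟨q, hq, rfl, hqv⟩ := hs.exists_of_mem_left hR
      exact ⟨q, List.mem_append_left _ hq, hqv, hRb⟩
    · obtain ⟨q, hq, hqv, hqb⟩ := hl.exists_of_mem_left hU
      exact ⟨q, List.mem_append_right _ hq, hqv, hqb hUb⟩
  cases hp : (Ls ++ Ll).argmax fun p => p.2 with
  | none =>
    rw [List.argmax_eq_none] at hp
    simp [hp] at hqL
  | some p =>
    refine meets_output ?_
    have hpV : V p.1 p.2 := by
      rcases List.mem_append.1 (List.argmax_mem hp) with h | h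
      · obtain ⟨x, hx, rfl, h⟩ := hs.exists_of_mem_right h
        exact h
      · obtain ⟨x, hx, h⟩ := hl.exists_of_mem_right h
        exact h.1
    have hle := List.le_of_mem_argmax hqL hp
    simp only [hV, abs_le] at hpV hqV
    linarith

end PartialEnumeration

/-! ### Measurability of the runs of partial enumeration -/

namespace PartialEnumeration

open QueryAlg

variable {n : ℕ} {c : Fin n → ℝ} {B : ℝ}

/-- A relation between reported values that respects all comparisons which partial enumeration
makes: of values, and of marginal densities with respect to a common base value. -/
def RespectsOrder (c : Fin n → ℝ) (R : ℝ → ℝ → Prop) : Prop :=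
  (∀ a a' b b', R a a' → R b b' → (a < b ↔ a' < b')) ∧
  ∀ v v' a a' b b', R v v' → R a a' → R b b' → ∀ d e,
    ((a - v) / c d < (b - v) / c e ↔ (a' - v') / c d < (b' - v') / c e)

theorem greedy_rel {R : ℝ → ℝ → Prop} (hR : RespectsOrder c R) (k : ℕ) (A : Finset (Fin n))
    (v v' : ℝ) (hv : R v v') :
    Rel R (fun p p' => p.1 = p'.1 ∧ R p.2 p'.2) (greedy c B k A v) (greedy c B k A v') := by
  induction k generalizing A v v' with
  | zero => exact ⟨rfl, hv⟩
  | succ k ih =>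
    refine (Rel.evaluate _ _).bind fun L L' hL => ?_
    have := hL.argmax_rel (f := fun p => (p.2 - v) / c p.1) (f' := fun p => (p.2 - v') / c p.1) (by
      rintro ⟨d, a⟩ ⟨d', a'⟩ ⟨e, b⟩ ⟨e', b'⟩ ⟨rfl, ha⟩ ⟨rfl, hb⟩
      exact hR.2 _ _ _ _ _ _ hv ha hb _ _)
    revert this
    cases L.argmax fun p => (p.2 - v) / c p.1 with
    | none =>
      cases L'.argmax fun p => (p.2 - v') / c p.1 with
      | none => exact fun _ => ⟨rfl, hv⟩
      | some p' => exact fun h => nomatch h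
    | some p =>
      cases L'.argmax fun p => (p.2 - v') / c p.1 with
      | none => exact fun h => nomatch h
      | some p' =>
        rintro (⟨h1, h2⟩ | _)
        simp only [h1]
        exact ih _ _ _ h2

theorem partialEnumeration_rel {R : ℝ → ℝ → Prop} (hR : RespectsOrder c R) :
    Rel R Eq (partialEnumeration c B) (partialEnumeration c B) := by
  refine (Rel.evaluate _ _).bind fun s s' hs =>
    (Rel.collect (g := fun U => .query U fun v => greedy c B n U v)
      (g' := fun U => .query U fun v => greedy c B n U v)
      (fun U => ⟨rfl, fun v v' hv => greedy_rel hR n U v v' hv⟩) _).bind fun l l' hl => ?_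
  have := (List.rel_append hs hl).argmax_rel (f := fun p => p.2) (f' := fun p => p.2)
    (by
      rintro ⟨d, a⟩ ⟨d', a'⟩ ⟨e, b⟩ ⟨e', b'⟩ ⟨-, ha⟩ ⟨-, hb⟩
      exact hR.1 _ _ _ _ ha hb)
  revert this
  cases (s ++ l).argmax fun p => p.2 with
  | none =>
    cases (s' ++ l').argmax fun p => p.2 with
    | none => exact fun _ => rfl
    | some p' => exact fun h => nomatch h
  | some p =>
    cases (s' ++ l').argmax fun p => p.2 with
    | none => exact fun h => nomatch h
    | some p' =>
      rintro (⟨h1, -⟩ | _)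
      exact h1

/-- A run of partial enumeration depends on the reported values only through finitely many
comparisons, so every property of the run is a measurable event. -/
theorem measurableSet_run (hn : 1 ≤ n) (hB : 0 ≤ B)
    (s : Set (List (Finset (Fin n)) × Finset (Fin n))) :
    MeasurableSet {est : ℕ → Finset (Fin n) → ℝ | (partialEnumeration c B).run est 0 ∈ s} := by
  -- only the first `4 n ^ 5` rounds matter
  let κ := Fin (4 * n ^ 5) × Finset (Fin n)
  let u : (ℕ → Finset (Fin n) → ℝ) → κ → ℝ := fun est k => est k.1 k.2
  let Φ : (ℕ → Finset (Fin n) → ℝ) →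
      (κ × κ → Prop) × (κ × κ × κ × Fin n × Fin n → Prop) := fun est =>
    (fun x => u est x.1 < u est x.2, fun x => (u est x.2.1 - u est x.1) / c x.2.2.2.1
      < (u est x.2.2.1 - u est x.1) / c x.2.2.2.2)
  have hu : ∀ k, Measurable fun est => u est k := fun k =>
    (measurable_pi_apply k.2).comp (measurable_pi_apply (k.1 : ℕ))
  have hΦ : Measurable Φ := by
    refine Measurable.prodMk (measurable_pi_lambda _ fun x => ?_)
      (measurable_pi_lambda _ fun x => ?_)
    · exact measurable_to_prop (by
        simpa [Set.preimage] using measurableSet_lt (hu x.1) (hu x.2))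
    · exact measurable_to_prop (by
        simpa [Set.preimage] using measurableSet_lt
          (((hu x.2.1).sub (hu x.1)).div_const _) (((hu x.2.2.1).sub (hu x.1)).div_const _))
  have hfac : ∀ est est', Φ est = Φ est' →
      (partialEnumeration c B).run est 0 = (partialEnumeration c B).run est' 0 := by
    intro est est' h
    have hm : ∀ e : ℕ → Finset (Fin n) → ℝ,
        ((partialEnumeration c B).run e 0).1.length ≤ 4 * n ^ 5 := fun e =>
      ((partialEnumeration_meets hn (fun _ _ => True) hB).run (fun _ _ => trivial) 0).2.1
    have hpos : 0 < 4 * n ^ 5 := by positivity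
    let cut : (ℕ → Finset (Fin n) → ℝ) → ℕ → Finset (Fin n) → ℝ := fun e j A =>
      u e (⟨min j (4 * n ^ 5 - 1), by omega⟩, A)
    have hcut : ∀ e, (partialEnumeration c B).run e 0 = (partialEnumeration c B).run (cut e) 0 :=
      fun e => run_congr_of_queried _ _ fun i A hi => by
        have : i < 4 * n ^ 5 := (List.getElem?_eq_some_iff.1 hi).1.trans_le (hm e)
        simp only [cut, u, Nat.zero_add]
        rw [min_eq_left (by omega)]
    rw [hcut est, hcut est']
    have hR : RespectsOrder c fun v v' => ∃ k, v = u est k ∧ v' = u est' k := by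
      constructor
      · rintro _ _ _ _ ⟨k, rfl, rfl⟩ ⟨l, rfl, rfl⟩
        exact iff_of_eq (congrFun (congrArg Prod.fst h) (k, l))
      · rintro _ _ _ _ _ _ ⟨k, rfl, rfl⟩ ⟨l, rfl, rfl⟩ ⟨m, rfl, rfl⟩ d e
        exact iff_of_eq (congrFun (congrArg Prod.snd h) (k, l, m, d, e))
    have := (partialEnumeration_rel (B := B) hR).run (est := cut est) (est' := cut est')
      (fun j A => ⟨_, rfl, rfl⟩) 0
    exact Prod.ext this.1 this.2
  have : {est | (partialEnumeration c B).run est 0 ∈ s}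
      = Φ ⁻¹' (Φ '' {est | (partialEnumeration c B).run est 0 ∈ s}) := by
    ext est
    constructor
    · intro h
      exact ⟨est, h, rfl⟩
    · rintro ⟨est', h, he⟩
      simpa [hfac _ _ he] using h
  rw [this]
  exact hΦ (Set.toFinite _).measurableSet

end PartialEnumeration

/-! ### The server's estimates -/

section Estimates

variable {n M : ℕ}

open CMAMAB

theorem serverMean_congr {r : ℕ} {G G' : Fin M → ℕ → Finset (Fin n) → ℝ}
    (s : ℕ → Finset (Fin M)) (j : ℕ)
    (h : ∀ i t, j * r ≤ t → t < j * r + r → G i t = G' i t) :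
    serverMean r G s j = serverMean r G' s j := by
  funext A
  unfold serverMean
  congr 1
  refine Finset.sum_congr rfl fun i _ => ?_
  congr 1
  refine Finset.sum_congr rfl fun t ht => ?_
  rw [h i _ (by omega) (by have := Finset.mem_range.1 ht; omega)]

theorem measurable_serverMean (r : ℕ) :
    Measurable fun x : (ℕ → Finset (Fin M)) × (Fin M → ℕ → Finset (Fin n) → ℝ) =>
      serverMean r x.2 x.1 := by
  refine measurable_pi_lambda _ fun j => measurable_pi_lambda _ fun A => ?_
  have h : Measurable fun x : Finset (Fin M) × (Fin M → ℕ → Finset (Fin n) → ℝ) =>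
      (∑ i ∈ x.1, (∑ s ∈ Finset.range r, x.2 i (j * r + s) A) / (r : ℝ)) / (x.1.card : ℝ) := by
    refine measurable_from_prod_countable_right fun S => ?_
    change Measurable fun y : Fin M → ℕ → Finset (Fin n) → ℝ =>
      (∑ i ∈ S, (∑ s ∈ Finset.range r, y i (j * r + s) A) / (r : ℝ)) / (S.card : ℝ)
    refine Measurable.div_const (Finset.measurable_fun_sum _ fun i _ =>
      Measurable.div_const (Finset.measurable_fun_sum _ fun t _ => ?_) _) _
    fun_prop
  have h1 : Measurable fun x : (ℕ → Finset (Fin M)) × (Fin M → ℕ → Finset (Fin n) → ℝ) =>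
      (x.1 j, x.2) := by fun_prop
  have h2 := h.comp h1
  simp only [Function.comp_def] at h2
  unfold serverMean
  exact h2

theorem measurable_serverMean_apply (r : ℕ) (s : ℕ → Finset (Fin M)) (j : ℕ)
    (A : Finset (Fin n)) :
    Measurable fun G : Fin M → ℕ → Finset (Fin n) → ℝ => serverMean r G s j A := by
  unfold serverMean
  refine Measurable.div_const (Finset.measurable_fun_sum _ fun i _ =>
    Measurable.div_const (Finset.measurable_fun_sum _ fun t _ => ?_) _) _
  fun_prop

variable {Ω : Type*} [MeasurableSpace Ω] {P : Measure Ω}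
  {F : Ω → Fin M → ℕ → Finset (Fin n) → ℝ} {f : Finset (Fin n) → ℝ}

theorem IsRewardModel.measurable_table (hF : IsRewardModel P F f) : Measurable F :=
  measurable_pi_lambda _ fun i => measurable_pi_lambda _ fun t => measurable_pi_lambda _ fun S =>
    hF.measurable i t S

/-- A function of the rewards before time `t₀` is independent of a function of the rewards from
time `t₀` on. -/
theorem IsRewardModel.indepFun_past_future (hF : IsRewardModel P F f) {τ σ : Type*}
    [MeasurableSpace τ] [MeasurableSpace σ] {φ : (Fin M → ℕ → Finset (Fin n) → ℝ) → τ}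
    {ψ : (Fin M → ℕ → Finset (Fin n) → ℝ) → σ} (hφ : Measurable φ) (hψ : Measurable ψ)
    (t₀ t₁ : ℕ) (hφ' : ∀ G G', (∀ i t, t < t₀ → G i t = G' i t) → φ G = φ G')
    (hψ' : ∀ G G', (∀ i t, t₀ ≤ t → t < t₁ → G i t = G' i t) → ψ G = ψ G') :
    IndepFun (fun ω => φ (F ω)) (fun ω => ψ (F ω)) P := by
  classical
  let S : Finset (Fin M × ℕ) := Finset.univ ×ˢ Finset.range t₀
  let S' : Finset (Fin M × ℕ) := Finset.univ ×ˢ Finset.Ico t₀ t₁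
  have hdisj : Disjoint S S' := by
    rw [Finset.disjoint_left]
    intro x hx hx'
    simp only [S, S', Finset.mem_product, Finset.mem_range, Finset.mem_Ico] at hx hx'
    omega
  let ext : (D : Finset (Fin M × ℕ)) → (D → Finset (Fin n) → ℝ) →
      Fin M → ℕ → Finset (Fin n) → ℝ := fun D y i t =>
    if h : (i, t) ∈ D then y ⟨(i, t), h⟩ else 0
  have hext : ∀ D, Measurable (ext D) := by
    intro D
    refine measurable_pi_lambda _ fun i => measurable_pi_lambda _ fun t => ?_
    by_cases h : (i, t) ∈ D
    · simpa [ext, h] using measurable_pi_apply _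
    · simp [ext, h]
  have hm : ∀ x : Fin M × ℕ, Measurable fun ω => F ω x.1 x.2 := fun x =>
    measurable_pi_lambda _ fun A => hF.measurable x.1 x.2 A
  have h := (hF.indep.indepFun_finset S S' hdisj hm).comp (hφ.comp (hext S)) (hψ.comp (hext S'))
  convert h using 1
  · funext ω
    refine hφ' _ _ fun i t ht => ?_
    simp [ext, S, ht]
  · funext ω
    refine hψ' _ _ fun i t ht ht' => ?_
    simp [ext, S', ht, ht']

theorem IsRewardModel.abs_sub_reward_le_one (hF : IsRewardModel P F f) {α : ℝ}
    (hα : α ∈ Set.Icc (0 : ℝ) 1) (ω : Ω) (i : Fin M) (t : ℕ) (S A : Finset (Fin n)) :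
    |α * F ω i t S - F ω i t A| ≤ 1 := by
  obtain ⟨h1, h2⟩ := hF.mem_Icc ω i t S
  obtain ⟨h3, h4⟩ := hF.mem_Icc ω i t A
  have h5 := mul_nonneg hα.1 h1
  have h6 := mul_le_one₀ hα.2 h1 h2
  rw [abs_le]
  constructor <;> linarith

theorem IsRewardModel.mean_mem_Icc [IsProbabilityMeasure P] (hF : IsRewardModel P F f)
    (i : Fin M) (S : Finset (Fin n)) : f S ∈ Set.Icc (0 : ℝ) 1 := by
  rw [← hF.mean S i 0]
  refine ⟨integral_nonneg fun ω => (hF.mem_Icc ω i 0 S).1, ?_⟩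
  have h : ∫ ω, F ω i 0 S ∂P ≤ ∫ _, (1 : ℝ) ∂P :=
    integral_mono_of_nonneg (Filter.Eventually.of_forall fun ω => (hF.mem_Icc ω i 0 S).1)
      (integrable_const _) (Filter.Eventually.of_forall fun ω => (hF.mem_Icc ω i 0 S).2)
  simpa using h

theorem IsRewardModel.integrable [IsProbabilityMeasure P] (hF : IsRewardModel P F f)
    (i : Fin M) (t : ℕ) (S : Finset (Fin n)) : Integrable (fun ω => F ω i t S) P :=
  Integrable.of_bound (hF.measurable i t S).aestronglyMeasurable 1
    (Filter.Eventually.of_forall fun ω => by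
      rw [Real.norm_eq_abs, abs_le]
      have := hF.mem_Icc ω i t S
      constructor <;> linarith [this.1, this.2])

/-- Hoeffding's bound for the centred sum of all rewards of the agents in `D` during `r` time
steps; the sign `σ` gives the upper and the lower tail. -/
theorem IsRewardModel.measure_sum_ge_le [IsProbabilityMeasure P] (hF : IsRewardModel P F f)
    (D : Finset (Fin M)) (t₀ r : ℕ) (A : Finset (Fin n)) {σ : ℝ} (hσ : |σ| = 1)
    {x : ℝ} (hx : 0 ≤ x) :
    P.real {ω | x ≤ ∑ y ∈ D ×ˢ Finset.range r, σ * (F ω y.1 (t₀ + y.2) A - f A)}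
      ≤ Real.exp (-x ^ 2 / (2 * (D.card * r / 4))) := by
  have hindep : iIndepFun (fun (y : Fin M × ℕ) ω => σ * (F ω y.1 (t₀ + y.2) A - f A)) P := by
    have h1 := hF.indep.precomp (g := fun y : Fin M × ℕ => (y.1, t₀ + y.2)) (by
      rintro ⟨a, b⟩ ⟨a', b'⟩ h
      simp only [Prod.mk.injEq, Nat.add_left_cancel_iff] at h
      exact Prod.ext h.1 h.2)
    exact h1.comp (fun _ G => σ * (G A - f A)) fun _ => by fun_prop
  have hsub : ∀ y ∈ D ×ˢ Finset.range r, HasSubgaussianMGF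
      (fun ω => σ * (F ω y.1 (t₀ + y.2) A - f A)) (1 / 4) P := by
    intro y _
    have h := hasSubgaussianMGF_of_mem_Icc (μ := P) (a := 0) (b := 1)
      (hF.measurable y.1 (t₀ + y.2) A).aemeasurable
      (Filter.Eventually.of_forall fun ω => hF.mem_Icc ω y.1 (t₀ + y.2) A)
    rw [hF.mean] at h
    have hquarter : (‖(1 : ℝ) - 0‖₊ / 2) ^ 2 = 1 / 4 := by
      rw [← NNReal.coe_inj]
      norm_num
    rw [hquarter] at h
    rcases eq_or_eq_neg_of_abs_eq hσ with rfl | rfl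
    · simpa using h
    · convert h.neg using 1
      funext ω
      simp
  refine (HasSubgaussianMGF.measure_sum_ge_le_of_iIndepFun hindep hsub hx).trans (le_of_eq ?_)
  simp [Finset.card_product]
  ring_nf

/-- The estimate of a fixed action in a fixed round is accurate with high probability. -/
theorem IsRewardModel.measure_serverMean_le [IsProbabilityMeasure P] (hF : IsRewardModel P F f)
    (s : ℕ → Finset (Fin M)) (j : ℕ) {r m : ℕ} (hr : 1 ≤ r) (hm : 1 ≤ m)
    (hs : (s j).card = m) (A : Finset (Fin n)) {ρ : ℝ} (hρ : 0 ≤ ρ) :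
    P.real {ω | ρ < |serverMean r (F ω) s j A - f A|} ≤ 2 * Real.exp (-(2 * (m * r) * ρ ^ 2)) := by
  have hm0 : (0 : ℝ) < m := by exact_mod_cast hm
  have hr0 : (0 : ℝ) < r := by exact_mod_cast hr
  have hsum : ∀ (σ : ℝ) ω, ∑ y ∈ s j ×ˢ Finset.range r, σ * (F ω y.1 (j * r + y.2) A - f A)
      = m * r * (σ * (serverMean r (F ω) s j A - f A)) := by
    intro σ ω
    have h1 : serverMean r (F ω) s j A
        = (∑ i ∈ s j, ∑ t ∈ Finset.range r, F ω i (j * r + t) A) / (m * r) := by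
      unfold serverMean
      rw [hs, ← Finset.sum_div, div_div, mul_comm (r : ℝ)]
    rw [h1, Finset.sum_product]
    simp only [mul_sub, Finset.sum_sub_distrib, ← Finset.mul_sum, Finset.sum_const, hs,
      Finset.card_range, nsmul_eq_mul]
    field_simp
  have hside : ∀ σ : ℝ, |σ| = 1 →
      P.real {ω | ρ ≤ σ * (serverMean r (F ω) s j A - f A)}
        ≤ Real.exp (-(2 * (m * r) * ρ ^ 2)) := by
    intro σ hσ
    have h := hF.measure_sum_ge_le (s j) (j * r) r A hσ (x := m * r * ρ) (by positivity)
    simp only [hsum, mul_le_mul_iff_right₀ (mul_pos hm0 hr0), hs] at h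
    refine h.trans (le_of_eq ?_)
    congr 1
    field_simp
    norm_num
  have hsubset : {ω | ρ < |serverMean r (F ω) s j A - f A|}
      ⊆ {ω | ρ ≤ 1 * (serverMean r (F ω) s j A - f A)}
        ∪ {ω | ρ ≤ -1 * (serverMean r (F ω) s j A - f A)} := by
    intro ω hω
    have hω : ρ < |serverMean r (F ω) s j A - f A| := hω
    rcases lt_abs.1 hω with h | h
    · exact Or.inl (by change ρ ≤ 1 * _; linarith)
    · exact Or.inr (by change ρ ≤ -1 * _; linarith)
  have h1 := hside 1 (by simp)
  have h2 := hside (-1) (by simp)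
  have h3 := (measureReal_mono hsubset (μ := P)).trans (measureReal_union_le _ _)
  linarith

end Estimates

/-! ### The expected regret for a fixed sequence of selections -/

section FixedSelection

open CMAMAB QueryAlg PartialEnumeration

variable {n M : ℕ} {c : Fin n → ℝ} {B : ℝ} {f : Finset (Fin n) → ℝ}

theorem value_run_of_accurate (hn : 1 ≤ n) (hc : ∀ v, 0 < c v) (hcB : ∀ v, c v ≤ B)
    (hmono : Monotone f) (hsub : IsSubmodular f)
    (hf0 : 0 ≤ f ∅) {ε κ Kt : ℝ} (hε : 0 ≤ ε) (hκ : 0 < κ) (hκc : ∀ v, κ ≤ c v)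
    (hKt : ∀ S, Feasible c B S → (S.card : ℝ) ≤ Kt) {S : Finset (Fin n)}
    (hS : Feasible c B S) {est : ℕ → Finset (Fin n) → ℝ}
    (hest : ∀ j A, ((partialEnumeration c B).run est 0).1[j]? = some A → |est j A - f A| ≤ ε) :
    (1 - 1 / Real.exp 1) * f S - (2 + 2 * Kt + 2 * (B / κ)) * ε
      ≤ f ((partialEnumeration c B).run est 0).2 := by
  classical
  obtain ⟨b, hb⟩ := partialEnumeration_meets_approx hn hc hcB hmono hsub hf0 hε hκ hκc hKt hS
  -- answers to queries that are not made may be replaced by exact ones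
  let est' : ℕ → Finset (Fin n) → ℝ := fun j A =>
    if ((partialEnumeration c B).run est 0).1[j]? = some A then est j A else f A
  have h1 : (partialEnumeration c B).run est 0 = (partialEnumeration c B).run est' 0 :=
    run_congr_of_queried _ _ fun i A hi => by simp [est', hi]
  have h2 : ∀ j A, |est' j A - f A| ≤ ε := by
    intro j A
    by_cases h : ((partialEnumeration c B).run est 0).1[j]? = some A
    · simpa [est', h] using hest j A h
    · simpa [est', h] using hε
  rw [h1]
  exact (hb.run h2 0).2.2

theorem length_run_le (hn : 1 ≤ n) (hB : 0 ≤ B) (est : ℕ → Finset (Fin n) → ℝ) :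
    ((partialEnumeration c B).run est 0).1.length ≤ 4 * n ^ 5 :=
  ((partialEnumeration_meets hn (fun _ _ => True) hB).run (fun _ _ => trivial) 0).2.1

theorem measurableSet_run_serverMean (hn : 1 ≤ n) (hB : 0 ≤ B) (r : ℕ)
    (S : Set (List (Finset (Fin n)) × Finset (Fin n))) :
    MeasurableSet {x : (ℕ → Finset (Fin M)) × (Fin M → ℕ → Finset (Fin n) → ℝ) |
      (partialEnumeration c B).run (serverMean r x.2 x.1) 0 ∈ S} :=
  measurable_serverMean r (measurableSet_run hn hB S)

theorem measurableSet_run_serverMean_left (hn : 1 ≤ n) (hB : 0 ≤ B) (r : ℕ)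
    (s : ℕ → Finset (Fin M)) (S : Set (List (Finset (Fin n)) × Finset (Fin n))) :
    MeasurableSet {G : Fin M → ℕ → Finset (Fin n) → ℝ |
      (partialEnumeration c B).run (serverMean r G s) 0 ∈ S} :=
  (measurable_prodMk_left (x := s)) (measurableSet_run_serverMean hn hB r S)

variable {Ω : Type*} [MeasurableSpace Ω] {P : Measure Ω} [IsProbabilityMeasure P]
  {F : Ω → Fin M → ℕ → Finset (Fin n) → ℝ}

theorem sum_measureReal_le_one {τ : Type*} [Fintype τ] (X : Ω → Option τ)
    (hX : ∀ a, MeasurableSet {ω | X ω = some a}) : ∑ a, P.real {ω | X ω = some a} ≤ 1 := by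
  rw [← measureReal_biUnion_finset (fun a _ b _ hab => Set.disjoint_left.2 fun ω ha hb =>
    hab (Option.some.inj (ha.symm.trans hb))) fun a _ => hX a]
  exact measureReal_le_one

/-- In each round the estimate of the queried action is inaccurate only with small probability.
The queried action is random, but it only depends on the rewards in earlier rounds. -/
theorem measure_inaccurate_le (hn : 1 ≤ n) (hB : 0 ≤ B) (hF : IsRewardModel P F f)
    (s : ℕ → Finset (Fin M)) (j : ℕ) {r m : ℕ} (hr : 1 ≤ r) (hm : 1 ≤ m)
    (hs : (s j).card = m) {ρ : ℝ} (hρ : 0 ≤ ρ) :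
    P.real {ω | ∃ A, ((partialEnumeration c B).run (serverMean r (F ω) s) 0).1[j]? = some A ∧
      ρ < |serverMean r (F ω) s j A - f A|} ≤ 2 * Real.exp (-(2 * (m * r) * ρ ^ 2)) := by
  set p := 2 * Real.exp (-(2 * (m * r) * ρ ^ 2))
  let X : (Fin M → ℕ → Finset (Fin n) → ℝ) → Option (Finset (Fin n)) := fun G =>
    ((partialEnumeration c B).run (serverMean r G s) 0).1[j]?
  have hX : ∀ A, MeasurableSet {G | X G = some A} := fun A =>
    measurableSet_run_serverMean_left hn hB r s {L | L.1[j]? = some A}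
  have hV : ∀ A, Measurable fun G : Fin M → ℕ → Finset (Fin n) → ℝ =>
      ρ < |serverMean r G s j A - f A| := fun A => by
    have h1 := measurable_serverMean_apply (n := n) r s j A
    exact measurableSet_setOfPred.1
      (measurableSet_lt measurable_const (h1.sub_const _).abs)
  have hmul : ∀ A, P.real ({ω | X (F ω) = some A} ∩ {ω | ρ < |serverMean r (F ω) s j A - f A|})
      ≤ P.real {ω | X (F ω) = some A} * p := by
    intro A
    have hind := hF.indepFun_past_future (φ := fun G => X G = some A)
      (ψ := fun G => ρ < |serverMean r G s j A - f A|) (hX A).mem (hV A) (j * r) (j * r + r)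
      (fun G G' h => by
        have : X G = X G' := getElem?_run_congr _ _ _ fun i hi =>
          serverMean_congr s i fun a t _ ht => h a t (by
            have : (i + 1) * r ≤ j * r := Nat.mul_le_mul_right r (by omega)
            rw [Nat.add_mul, Nat.one_mul] at this
            omega)
        rw [this])
      (fun G G' h => by rw [serverMean_congr s j h])
    have h1 := hind.measure_inter_preimage_eq_mul {True} {True} (MeasurableSet.singleton _)
      (MeasurableSet.singleton _)
    have h2 : P.real ({ω | X (F ω) = some A} ∩ {ω | ρ < |serverMean r (F ω) s j A - f A|})
        = P.real {ω | X (F ω) = some A} * P.real {ω | ρ < |serverMean r (F ω) s j A - f A|} := by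
      simp only [Measure.real, ← ENNReal.toReal_mul]
      simpa [Set.preimage] using congrArg ENNReal.toReal h1
    rw [h2]
    exact mul_le_mul_of_nonneg_left (hF.measure_serverMean_le s j hr hm hs A hρ)
      measureReal_nonneg
  calc _ ≤ P.real (⋃ A ∈ (Finset.univ : Finset (Finset (Fin n))),
          ({ω | X (F ω) = some A} ∩ {ω | ρ < |serverMean r (F ω) s j A - f A|})) := by
        refine measureReal_mono (fun ω => ?_) (measure_ne_top P _)
        rintro ⟨A, h1, h2⟩
        simp only [Set.mem_iUnion]
        exact ⟨A, Finset.mem_univ A, h1, h2⟩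
    _ ≤ ∑ A, P.real ({ω | X (F ω) = some A} ∩ {ω | ρ < |serverMean r (F ω) s j A - f A|}) :=
        measureReal_biUnion_finset_le _ _
    _ ≤ ∑ A, P.real {ω | X (F ω) = some A} * p := Finset.sum_le_sum fun A _ => hmul A
    _ = (∑ A, P.real {ω | X (F ω) = some A}) * p := by rw [Finset.sum_mul]
    _ ≤ 1 * p := mul_le_mul_of_nonneg_right
        (sum_measureReal_le_one _ fun A => hF.measurable_table (hX A)) (by positivity)
    _ = p := one_mul p

/-- The final action only depends on the rewards during exploration, so that later its expected
reward is its mean value. -/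
theorem integral_reward_output (hn : 1 ≤ n) (hB : 0 ≤ B) (hF : IsRewardModel P F f)
    (s : ℕ → Finset (Fin M)) (r : ℕ) (i : Fin M) {t : ℕ} (ht : 4 * n ^ 5 * r ≤ t) :
    ∫ ω, F ω i t ((partialEnumeration c B).run (serverMean r (F ω) s) 0).2 ∂P
      = ∫ ω, f ((partialEnumeration c B).run (serverMean r (F ω) s) 0).2 ∂P := by
  classical
  let X : (Fin M → ℕ → Finset (Fin n) → ℝ) → Finset (Fin n) := fun G =>
    ((partialEnumeration c B).run (serverMean r G s) 0).2
  have hX : ∀ A, MeasurableSet {G | X G = A} := fun A =>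
    measurableSet_run_serverMean_left hn hB r s {L | L.2 = A}
  let φ : Finset (Fin n) → (Fin M → ℕ → Finset (Fin n) → ℝ) → ℝ := fun A G =>
    if X G = A then 1 else 0
  have hφ : ∀ A, Measurable (φ A) := fun A =>
    Measurable.ite (hX A) measurable_const measurable_const
  have hφF : ∀ A, Measurable fun ω => φ A (F ω) := fun A => (hφ A).comp hF.measurable_table
  have hbound : ∀ A ω, ‖φ A (F ω)‖ ≤ 1 := fun A ω => by
    simp only [φ]; split_ifs <;> simp
  have hind : ∀ A, IndepFun (fun ω => φ A (F ω)) (fun ω => F ω i t A) P := fun A =>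
    hF.indepFun_past_future (ψ := fun G => G i t A) (hφ A) (by fun_prop) t (t + 1)
      (fun G G' h => by
        have : X G = X G' := by
          refine congrArg Prod.snd (run_congr_of_queried _ _ fun k A hk => ?_)
          have hk' : k < 4 * n ^ 5 :=
            (List.getElem?_eq_some_iff.1 hk).1.trans_le (length_run_le hn hB _)
          rw [Nat.zero_add]
          refine congrFun (serverMean_congr s k fun a t' _ ht' => h a t' ?_) A
          have : (k + 1) * r ≤ 4 * n ^ 5 * r := Nat.mul_le_mul_right r (by omega)
          rw [Nat.add_mul, Nat.one_mul] at this
          omega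
        simp only [φ, this])
      (fun G G' h => by rw [h i t le_rfl (by omega)])
  have h1 : ∀ ω, F ω i t (X (F ω)) = ∑ A, φ A (F ω) * F ω i t A := fun ω => by simp [φ]
  have h2 : ∀ ω, f (X (F ω)) = ∑ A, φ A (F ω) * f A := fun ω => by simp [φ]
  change ∫ ω, F ω i t (X (F ω)) ∂P = ∫ ω, f (X (F ω)) ∂P
  simp only [h1, h2]
  rw [integral_finsetSum, integral_finsetSum]
  · refine Finset.sum_congr rfl fun A _ => ?_
    rw [(hind A).integral_fun_mul_eq_mul_integral (hφF A).aestronglyMeasurable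
      (hF.measurable i t A).aestronglyMeasurable, hF.mean, integral_mul_const]
  · intro A _
    exact (Integrable.of_bound (hφF A).aestronglyMeasurable 1
      (Filter.Eventually.of_forall (hbound A))).mul_const _
  · intro A _
    exact (hF.integrable i t A).bdd_mul (hφF A).aestronglyMeasurable
      (Filter.Eventually.of_forall (hbound A))

theorem one_sub_one_div_exp_mem_Icc : 1 - 1 / Real.exp 1 ∈ Set.Icc (0 : ℝ) 1 := by
  have h1 : 1 / Real.exp 1 ≤ 1 := (div_le_one (Real.exp_pos 1)).2 (Real.one_le_exp zero_le_one)
  have h2 : 0 ≤ 1 / Real.exp 1 := by positivity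
  constructor <;> linarith

theorem measurableSet_play (hn : 1 ≤ n) (hB : 0 ≤ B) (par : ResilienceParams) (m T t : ℕ)
    (A : Finset (Fin n)) :
    MeasurableSet {x : (ℕ → Finset (Fin M)) × (Fin M → ℕ → Finset (Fin n) → ℝ) |
      play par (fun _ => partialEnumeration c B) m T x.2 x.1 t = A} :=
  measurableSet_run_serverMean hn hB (reps par m T)
    {L | (if t < L.1.length * reps par m T then L.1.getD (t / reps par m T) L.2 else L.2) = A}

theorem measurable_reward_play (hn : 1 ≤ n) (hB : 0 ≤ B) (par : ResilienceParams) (m T t : ℕ)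
    (i : Fin M) :
    Measurable fun x : (ℕ → Finset (Fin M)) × (Fin M → ℕ → Finset (Fin n) → ℝ) =>
      x.2 i t (play par (fun _ => partialEnumeration c B) m T x.2 x.1 t) := by
  classical
  have h : ∀ x : (ℕ → Finset (Fin M)) × (Fin M → ℕ → Finset (Fin n) → ℝ),
      x.2 i t (play par (fun _ => partialEnumeration c B) m T x.2 x.1 t)
        = ∑ A, if play par (fun _ => partialEnumeration c B) m T x.2 x.1 t = A
            then x.2 i t A else 0 := fun x => by simp
  simp only [h]
  exact Finset.measurable_fun_sum _ fun A _ =>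
    Measurable.ite (measurableSet_play hn hB par m T t A) (by fun_prop) measurable_const

theorem measurable_regret (hn : 1 ≤ n) (hB : 0 ≤ B) (par : ResilienceParams) (m T : ℕ)
    (α : ℝ) (S : Finset (Fin n)) (i : Fin M) :
    Measurable fun x : (ℕ → Finset (Fin M)) × (Fin M → ℕ → Finset (Fin n) → ℝ) =>
      regret par (fun _ => partialEnumeration c B) m T α S x.2 x.1 i := by
  unfold regret
  refine Finset.measurable_fun_sum _ fun t _ => ?_
  exact Measurable.sub (by fun_prop) (measurable_reward_play hn hB par m T t i)

/-- Exploration takes at most `4 n ^ 5 r` steps, each with regret at most `1`. Each later step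
costs the approximation error of partial enumeration, plus the probability that some estimate
is inaccurate. -/
theorem integral_regret_le (hn : 1 ≤ n) (hc : ∀ v, 0 < c v) (hcB : ∀ v, c v ≤ B)
    (hmono : Monotone f) (hsub : IsSubmodular f) {κ Kt : ℝ} (hκ : 0 < κ) (hκc : ∀ v, κ ≤ c v)
    (hKt : ∀ S, Feasible c B S → (S.card : ℝ) ≤ Kt) {S : Finset (Fin n)}
    (hS : Feasible c B S) (hF : IsRewardModel P F f) {m : ℕ} (hm : 1 ≤ m)
    {s : ℕ → Finset (Fin M)} (hs : ∀ j, (s j).card = m) (par : ResilienceParams) (T : ℕ)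
    (hr : 1 ≤ reps par m T) {ρ : ℝ} (hρ : 0 ≤ ρ) (i : Fin M) :
    ∫ ω, regret par (fun _ => partialEnumeration c B) m T (1 - 1 / Real.exp 1) S (F ω) s i ∂P
      ≤ 4 * n ^ 5 * reps par m T + T * ((2 + 2 * Kt + 2 * (B / κ)) * ρ
        + 4 * n ^ 5 * (2 * Real.exp (-(2 * (m * reps par m T) * ρ ^ 2)))) := by
  classical
  have hB : 0 ≤ B := (hc ⟨0, hn⟩).le.trans (hcB _)
  have hKt0 : 0 ≤ Kt := by simpa using hKt ∅ (by simpa [Feasible, cost] using hB)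
  have hα := one_sub_one_div_exp_mem_Icc
  set α := 1 - 1 / Real.exp 1
  set r := reps par m T with hrdef
  set η := (2 + 2 * Kt + 2 * (B / κ)) * ρ with hη
  set p := 2 * Real.exp (-(2 * (m * r) * ρ ^ 2)) with hp
  have hη0 : 0 ≤ η := by positivity
  let X : Ω → Finset (Fin n) := fun ω =>
    ((partialEnumeration c B).run (serverMean r (F ω) s) 0).2
  have hXm : ∀ A, MeasurableSet {ω | X ω = A} := fun A => hF.measurable_table
    (measurableSet_run_serverMean_left hn hB r s {L | L.2 = A})
  have hX : Measurable X := measurable_to_countable' hXm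
  -- the final action is good unless some estimate is inaccurate
  have hbad : P.real {ω | η < α * f S - f (X ω)} ≤ 4 * n ^ 5 * p := by
    calc _ ≤ P.real (⋃ j ∈ Finset.range (4 * n ^ 5), {ω | ∃ A,
            ((partialEnumeration c B).run (serverMean r (F ω) s) 0).1[j]? = some A ∧
              ρ < |serverMean r (F ω) s j A - f A|}) := by
          refine measureReal_mono (fun ω hω => ?_) (measure_ne_top P _)
          by_contra hcon
          have hacc := value_run_of_accurate hn hc hcB hmono hsub
            (hF.mean_mem_Icc i ∅).1 hρ hκ hκc hKt hS (est := serverMean r (F ω) s) (by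
              intro j A hj
              by_contra hlt
              refine hcon (Set.mem_biUnion (x := j) ?_ ⟨A, hj, not_le.1 hlt⟩)
              have := (List.getElem?_eq_some_iff.1 hj).1.trans_le (length_run_le hn hB _)
              simpa using this)
          have hω : η < α * f S - f (X ω) := hω
          change α * f S - η ≤ f (X ω) at hacc
          linarith
      _ ≤ ∑ j ∈ Finset.range (4 * n ^ 5), P.real {ω | ∃ A,
            ((partialEnumeration c B).run (serverMean r (F ω) s) 0).1[j]? = some A ∧
              ρ < |serverMean r (F ω) s j A - f A|} := measureReal_biUnion_finset_le _ _
      _ ≤ ∑ j ∈ Finset.range (4 * n ^ 5), p := Finset.sum_le_sum fun j _ =>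
          measure_inaccurate_le hn hB hF s j hr hm (hs j) hρ
      _ = 4 * n ^ 5 * p := by simp
  have hHm : MeasurableSet {ω | η < α * f S - f (X ω)} :=
    hX (Set.toFinite {A | η < α * f S - f A}).measurableSet
  have hfX : Integrable (fun ω => f (X ω)) P :=
    Integrable.of_bound ((measurable_of_finite f).comp hX).aestronglyMeasurable 1
      (Filter.Eventually.of_forall fun ω => by
        have := hF.mean_mem_Icc i (X ω)
        rw [Real.norm_eq_abs, abs_le]
        constructor <;> linarith [this.1, this.2])
  have hval : α * f S - ∫ ω, f (X ω) ∂P ≤ η + 4 * n ^ 5 * p := by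
    have h1 : ∫ ω, (α * f S - f (X ω)) ∂P
        ≤ ∫ ω, (η + Set.indicator {ω | η < α * f S - f (X ω)} (fun _ => (1 : ℝ)) ω) ∂P := by
      refine integral_mono ((integrable_const _).sub hfX)
        ((integrable_const _).add ((integrable_const _).indicator hHm)) fun ω => ?_
      by_cases h : η < α * f S - f (X ω)
      · rw [Set.indicator_of_mem (show ω ∈ {ω | η < α * f S - f (X ω)} from h)]
        have h2 := (hF.mean_mem_Icc i (X ω)).1
        have h3 := hF.mean_mem_Icc i S
        have h4 := mul_le_one₀ hα.2 h3.1 h3.2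
        linarith
      · rw [Set.indicator_of_notMem (show ω ∉ {ω | η < α * f S - f (X ω)} from h)]
        linarith
    rw [integral_sub (integrable_const _) hfX, integral_add (integrable_const _)
      ((integrable_const _).indicator hHm), integral_indicator_const _ hHm] at h1
    simp only [integral_const, probReal_univ, smul_eq_mul, mul_one] at h1
    linarith
  have hint : ∀ t, Integrable (fun ω => α * F ω i t S
      - F ω i t (play par (fun _ => partialEnumeration c B) m T (F ω) s t)) P := by
    intro t
    refine Integrable.of_bound (Measurable.aestronglyMeasurable ?_) 1
      (Filter.Eventually.of_forall fun ω => hF.abs_sub_reward_le_one hα ω i t _ _)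
    have h1 : Measurable fun ω => (s, F ω) := measurable_const.prodMk hF.measurable_table
    exact ((hF.measurable i t S).const_mul α).sub
      ((measurable_reward_play hn hB par m T t i).comp h1)
  have hstep : ∀ t, ∫ ω, (α * F ω i t S
      - F ω i t (play par (fun _ => partialEnumeration c B) m T (F ω) s t)) ∂P
      ≤ (if t < 4 * n ^ 5 * r then 1 else 0) + (η + 4 * n ^ 5 * p) := by
    intro t
    split_ifs with ht
    · have h1 := integral_mono (hint t) (integrable_const (1 : ℝ)) fun ω =>
        (le_abs_self _).trans (hF.abs_sub_reward_le_one hα ω i t _ _)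
      simp only [integral_const, probReal_univ, one_smul] at h1
      have : 0 ≤ 4 * (n : ℝ) ^ 5 * p := by positivity
      linarith
    · have hplay : ∀ ω, play par (fun _ => partialEnumeration c B) m T (F ω) s t = X ω := by
        intro ω
        unfold play
        rw [if_neg]
        · rfl
        · exact fun h => ht (h.trans_le (Nat.mul_le_mul_right r (length_run_le hn hB _)))
      have hFX : Integrable (fun ω => F ω i t (X ω)) P := by
        have := ((hF.integrable i t S).const_mul α).sub (hint t)
        refine this.congr (Filter.Eventually.of_forall fun ω => ?_)
        simp [hplay]
      simp only [hplay]
      rw [integral_sub ((hF.integrable i t S).const_mul α) hFX, integral_const_mul, hF.mean,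
        integral_reward_output hn hB hF s r i (not_lt.1 ht)]
      linarith
  unfold regret
  rw [integral_finsetSum _ fun t _ => hint t]
  refine (Finset.sum_le_sum fun t _ => hstep t).trans ?_
  rw [Finset.sum_add_distrib, Finset.sum_const, Finset.card_range, nsmul_eq_mul,
    ← Finset.sum_filter, Finset.sum_const, nsmul_eq_mul, mul_one]
  have hcard : (((Finset.range T).filter fun t => t < 4 * n ^ 5 * r).card : ℝ)
      ≤ 4 * n ^ 5 * r := by
    have : ((Finset.range T).filter fun t => t < 4 * n ^ 5 * r).card ≤ 4 * n ^ 5 * r := by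
      refine (Finset.card_le_card fun t ht => ?_).trans_eq (Finset.card_range (4 * n ^ 5 * r))
      exact Finset.mem_range.2 (Finset.mem_filter.1 ht).2
    exact_mod_cast this
  linarith

end FixedSelection

/-! ### Averaging over the selections -/

section RandomSelection

open CMAMAB QueryAlg PartialEnumeration

variable {n M : ℕ} {c : Fin n → ℝ} {B : ℝ} {f : Finset (Fin n) → ℝ}
  {Ω : Type*} [MeasurableSpace Ω] {P : Measure Ω} [IsProbabilityMeasure P]
  {F : Ω → Fin M → ℕ → Finset (Fin n) → ℝ} {sel : Ω → ℕ → Finset (Fin M)}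

theorem integrable_regret (hn : 1 ≤ n) (hB : 0 ≤ B) (hF : IsRewardModel P F f) {m : ℕ}
    (hsel : IsSelection P m F sel) (par : ResilienceParams) (m' T : ℕ) {α : ℝ}
    (hα : α ∈ Set.Icc (0 : ℝ) 1) (S : Finset (Fin n)) (i : Fin M) :
    Integrable (fun ω => regret par (fun _ => partialEnumeration c B) m' T α S (F ω) (sel ω) i)
      P := by
  have hselm : Measurable sel := measurable_pi_lambda _ hsel.measurable
  have h1 : Measurable fun ω => (sel ω, F ω) := hselm.prodMk hF.measurable_table
  refine Integrable.of_bound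
    ((measurable_regret hn hB par m' T α S i).comp h1).aestronglyMeasurable T
    (Filter.Eventually.of_forall fun ω => ?_)
  unfold regret
  refine (norm_sum_le _ _).trans ((Finset.sum_le_sum fun t _ =>
    hF.abs_sub_reward_le_one hα ω i t _ _).trans ?_)
  simp

/-- The selections are independent of the rewards, so a bound on the expected regret for every
fixed sequence of selections carries over to random selections. -/
theorem integral_regret_le_of_forall (hn : 1 ≤ n) (hB : 0 ≤ B) (hF : IsRewardModel P F f)
    {m : ℕ} (hsel : IsSelection P m F sel) (par : ResilienceParams) (T : ℕ) {α : ℝ}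
    (hα : α ∈ Set.Icc (0 : ℝ) 1) (S : Finset (Fin n)) (i : Fin M) {b : ℝ}
    (hb : ∀ s : ℕ → Finset (Fin M), (∀ j, (s j).card = m) →
      ∫ ω, regret par (fun _ => partialEnumeration c B) m T α S (F ω) s i ∂P ≤ b) :
    ∫ ω, regret par (fun _ => partialEnumeration c B) m T α S (F ω) (sel ω) i ∂P ≤ b := by
  have hselm : Measurable sel := measurable_pi_lambda _ hsel.measurable
  have hFm := hF.measurable_table
  have hpair : Measurable fun ω => (sel ω, F ω) := hselm.prodMk hFm
  let R : (ℕ → Finset (Fin M)) × (Fin M → ℕ → Finset (Fin n) → ℝ) → ℝ := fun x =>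
    regret par (fun _ => partialEnumeration c B) m T α S x.2 x.1 i
  have hR : Measurable R := measurable_regret hn hB par m T α S i
  have hlaw := (indepFun_iff_map_prod_eq_prod_map_map hselm.aemeasurable hFm.aemeasurable).1
    hsel.indep
  have : IsProbabilityMeasure (P.map sel) := Measure.isProbabilityMeasure_map hselm.aemeasurable
  have : IsProbabilityMeasure (P.map F) := Measure.isProbabilityMeasure_map hFm.aemeasurable
  have hint : Integrable R ((P.map sel).prod (P.map F)) := by
    rw [← hlaw, integrable_map_measure hR.aestronglyMeasurable hpair.aemeasurable]
    exact integrable_regret hn hB hF hsel par m T hα S i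
  calc ∫ ω, R (sel ω, F ω) ∂P = ∫ x, R x ∂(P.map fun ω => (sel ω, F ω)) :=
        (integral_map hpair.aemeasurable hR.aestronglyMeasurable).symm
    _ = ∫ s, ∫ G, R (s, G) ∂(P.map F) ∂(P.map sel) := by rw [hlaw, integral_prod _ hint]
    _ ≤ ∫ _, b ∂(P.map sel) := by
        refine integral_mono_ae hint.integral_prod_left (integrable_const b) ?_
        have hcard : MeasurableSet {s : ℕ → Finset (Fin M) | ∀ j, (s j).card = m} := by
          have h : ∀ j, Measurable fun s : ℕ → Finset (Fin M) => (s j).card := fun j =>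
            (measurable_of_finite Finset.card).comp (measurable_pi_apply j)
          rw [Set.ofPred_forall]
          exact MeasurableSet.iInter fun j => h j (measurableSet_singleton m)
        have h := (ae_map_iff (μ := P) hselm.aemeasurable hcard).2
          (Filter.Eventually.of_forall fun ω => hsel.card_eq ω)
        filter_upwards [h] with s hs
        have hRs : Measurable fun G => R (s, G) := hR.comp measurable_prodMk_left
        rw [integral_map hFm.aemeasurable hRs.aestronglyMeasurable]
        exact hb s hs
    _ = b := by simp

end RandomSelection

/-! ### The choice of the number of repetitions -/

theorem le_of_pow_three_le {a b k : ℝ} (hb : 0 ≤ b) (hk : 0 ≤ k) (h : a ^ 3 ≤ k ^ 3 * b ^ 3) :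
    a ≤ k * b := by
  rw [← mul_pow] at h
  exact le_of_pow_le_pow_left₀ (by norm_num) (by positivity) h

/-- With `y = (δ √L T m / N) ^ (2/3)` and `m r ≈ y`, the exploration cost `N r` and the
exploitation cost `T δ √(L / (m r))` are of the same order. Here `N` stands for `n ^ 5`, `L` for
`log T`, and `X` for the resulting bound. -/
theorem balance_exploration {N m T K q L δ y X r : ℝ} (hN : 1 ≤ N) (hm : 1 ≤ m)
    (hT : N * m ≤ T) (hK : 1 ≤ K) (hq : 1 ≤ q) (hL : 1 / 2 ≤ L) (hδ : δ = 4 + 2 * K + 2 * q)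
    (hX0 : 0 ≤ X) (hX : X ^ 3 = K ^ 2 * q ^ 2 * N * T ^ 2 * L / m)
    (hy0 : 0 < y) (hy : y ^ 3 = δ ^ 2 * L * T ^ 2 * m ^ 2 / N ^ 2)
    (hr : y / m ≤ r) (hr' : r ≤ y / m + 1) :
    4 * N * r + T * (δ * √(L / (m * r)) + 8 * N / T ^ 2) ≤ 44 * X := by
  have hm0 : 0 < m := by linarith
  have hN0 : 0 < N := by linarith
  have hNm : N ≤ N * m := by nlinarith
  have hT0 : 0 < T := by linarith
  have hδ0 : 0 < δ := by linarith
  have hδK : δ ≤ 8 * (K * q) := by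
    have h := mul_nonneg (sub_nonneg.2 hK) (sub_nonneg.2 hq)
    nlinarith
  have hδ2 : δ ^ 2 ≤ 64 * (K ^ 2 * q ^ 2) := by
    calc δ ^ 2 ≤ (8 * (K * q)) ^ 2 := pow_le_pow_left₀ hδ0.le hδK 2
      _ = _ := by ring
  have hZ : N * T ^ 2 * L * δ ^ 2 / m ≤ 64 * X ^ 3 := by
    rw [hX]
    calc N * T ^ 2 * L * δ ^ 2 / m ≤ N * T ^ 2 * L * (64 * (K ^ 2 * q ^ 2)) / m := by gcongr
      _ = _ := by ring
  have h1 : N * (y / m) ≤ 4 * X := by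
    refine le_of_pow_three_le hX0 (by norm_num) ?_
    calc (N * (y / m)) ^ 3 = N ^ 3 * y ^ 3 / m ^ 3 := by ring
      _ = N * T ^ 2 * L * δ ^ 2 / m := by rw [hy]; field_simp
      _ ≤ _ := by linarith
  have h2 : N ≤ 2 * X := by
    refine le_of_pow_three_le hX0 (by norm_num) ?_
    have e1 : (1 : ℝ) ≤ K ^ 2 * q ^ 2 := by
      calc (1 : ℝ) = 1 * 1 := by ring
        _ ≤ _ := mul_le_mul (one_le_pow₀ hK) (one_le_pow₀ hq) (by norm_num) (by positivity)
    have e2 : N ^ 2 * m ≤ T ^ 2 := by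
      calc N ^ 2 * m ≤ N ^ 2 * m * m := le_mul_of_one_le_right (by positivity) hm
        _ = (N * m) ^ 2 := by ring
        _ ≤ T ^ 2 := pow_le_pow_left₀ (by positivity) hT 2
    rw [hX]
    calc N ^ 3 = 2 * (1 * N * (N ^ 2 * m) * (1 / 2) / m) := by field_simp
      _ ≤ 2 * (K ^ 2 * q ^ 2 * N * T ^ 2 * L / m) := by gcongr
      _ ≤ _ := by
        have : 0 ≤ K ^ 2 * q ^ 2 * N * T ^ 2 * L / m := by positivity
        linarith
  have hmr : y ≤ m * r := by rw [div_le_iff₀ hm0] at hr; linarith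
  have h3 : T * (δ * √(L / (m * r))) ≤ 4 * X := by
    have e1 : √(L / (m * r)) ≤ √(L / y) :=
      Real.sqrt_le_sqrt (div_le_div_of_nonneg_left (by linarith) hy0 hmr)
    have e2 : T * (δ * √(L / y)) ≤ 4 * X := by
      have hsq : √(L / y) ^ 2 = L / y := Real.sq_sqrt (by positivity)
      refine le_of_pow_three_le hX0 (by norm_num) ?_
      refine le_of_pow_le_pow_left₀ (n := 2) (by norm_num) (by positivity) ?_
      calc ((T * (δ * √(L / y))) ^ 3) ^ 2 = T ^ 6 * δ ^ 6 * (√(L / y) ^ 2) ^ 3 := by ring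
        _ = T ^ 6 * δ ^ 6 * L ^ 3 / y ^ 3 := by rw [hsq]; ring
        _ = (N * T ^ 2 * L * δ ^ 2 / m) ^ 2 := by rw [hy]; field_simp
        _ ≤ (64 * X ^ 3) ^ 2 := pow_le_pow_left₀ (by positivity) hZ 2
        _ = (4 ^ 3 * X ^ 3) ^ 2 := by ring
    exact (mul_le_mul_of_nonneg_left (mul_le_mul_of_nonneg_left e1 hδ0.le) hT0.le).trans e2
  have h4 : T * (8 * N / T ^ 2) ≤ 8 * N := by
    have : T * (8 * N / T ^ 2) = 8 * N / T := by field_simp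
    rw [this, div_le_iff₀ hT0]
    nlinarith
  have h5 : 4 * N * r ≤ 4 * N * (y / m + 1) := mul_le_mul_of_nonneg_left hr' (by positivity)
  linarith

theorem mainTheorem8 :
    ∃ C : ℝ, 0 < C ∧
      ∀ (n : ℕ) (c : Fin n → ℝ) (B Kt : ℝ) (M m T : ℕ)
        (Ω : Type*) [MeasurableSpace Ω] (P : Measure Ω) [IsProbabilityMeasure P]
        (f : Finset (Fin n) → ℝ) (F : Ω → Fin M → ℕ → Finset (Fin n) → ℝ)
        (sel : Ω → ℕ → Finset (Fin M)) (Sopt : Finset (Fin n))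
        (par : ResilienceParams),
        1 ≤ n → (∀ v, 0 < c v ∧ c v ≤ B) → B ≤ ∑ v, c v →
        (∀ S, Feasible c B S → (S.card : ℝ) ≤ Kt) →
        1 ≤ m → m ≤ M →
        Monotone f → IsSubmodular f → IsOptimal c B f Sopt →
        IsRewardModel P F f → IsSelection P m F sel →
        par = { β := 0, γ := 0, ψ := (n : ℝ) ^ 5, δ := 4 + 2 * Kt + 2 * budgetRatio c B } →
        (∀ ω, (CMAMAB.commRounds par (fun _ => partialEnumeration c B) m T (F ω) (sel ω) : ℝ)
            ≤ C * (n : ℝ) ^ 5) ∧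
        (∀ ω t, Feasible c B
            (CMAMAB.play par (fun _ => partialEnumeration c B) m T (F ω) (sel ω) t)) ∧
        (2 ≤ T → n ^ 5 * m ≤ T → ∀ i : Fin M,
          Integrable (fun ω => CMAMAB.regret par (fun _ => partialEnumeration c B) m T
            (1 - 1 / Real.exp 1) Sopt (F ω) (sel ω) i) P ∧
          ∫ ω, CMAMAB.regret par (fun _ => partialEnumeration c B) m T
              (1 - 1 / Real.exp 1) Sopt (F ω) (sel ω) i ∂P
            ≤ C * ((m : ℝ) ^ (-(1 / 3) : ℝ) * Kt ^ (2 / 3 : ℝ) * budgetRatio c B ^ (2 / 3 : ℝ)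
                * (n : ℝ) ^ (5 / 3 : ℝ) * (T : ℝ) ^ (2 / 3 : ℝ)
                * Real.log T ^ (1 / 3 : ℝ))) := by
  refine ⟨44, by norm_num, ?_⟩
  intro n c B Kt M m T Ω _ P _ f F sel Sopt par hn hc hBsum hKt hm hmM hmono hsub hopt hF hsel hpar
  have hc0 : ∀ v, 0 < c v := fun v => (hc v).1
  have hcB : ∀ v, c v ≤ B := fun v => (hc v).2
  have hB : 0 ≤ B := (hc0 ⟨0, hn⟩).le.trans (hcB _)
  have hmeets := PartialEnumeration.partialEnumeration_meets (c := c) hn (fun _ _ => True) hB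
  refine ⟨fun ω => ?_, fun ω t => ?_, fun hT2 hT i => ?_⟩
  · have h : CMAMAB.commRounds par (fun _ => partialEnumeration c B) m T (F ω) (sel ω)
        ≤ 4 * n ^ 5 := length_run_le hn hB _
    have h' : (CMAMAB.commRounds par (fun _ => partialEnumeration c B) m T (F ω) (sel ω) : ℝ)
        ≤ 4 * n ^ 5 := by exact_mod_cast h
    have : (0 : ℝ) ≤ (n : ℝ) ^ 5 := by positivity
    linarith
  · obtain ⟨h1, -, h3⟩ := hmeets.run (est := CMAMAB.serverMean (CMAMAB.reps par m T) (F ω) (sel ω))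
      (fun _ _ => trivial) 0
    change ∀ A ∈ (CMAMAB.trace par (fun _ => partialEnumeration c B) m T (F ω) (sel ω)).1, _ at h1
    change Feasible c B
      (CMAMAB.trace par (fun _ => partialEnumeration c B) m T (F ω) (sel ω)).2 at h3
    unfold CMAMAB.play
    split_ifs
    · rw [List.getD_eq_getElem?_getD]
      cases h : (CMAMAB.trace par (fun _ => partialEnumeration c B) m T (F ω) (sel ω)).1[
        t / CMAMAB.reps par m T]? with
      | none => exact h3
      | some A => exact h1 A (List.mem_of_getElem? h)
    · exact h3
  · have hα := one_sub_one_div_exp_mem_Icc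
    refine ⟨integrable_regret hn hB hF hsel par m T hα Sopt i, ?_⟩
    have : Nonempty (Fin n) := ⟨⟨0, hn⟩⟩
    obtain ⟨v₀, hv₀⟩ := exists_eq_ciInf_of_finite (f := c)
    have hκ : 0 < ⨅ v, c v := hv₀ ▸ hc0 v₀
    have hκc : ∀ v, ⨅ v, c v ≤ c v := fun v => ciInf_le (Set.finite_range c).bddBelow v
    have hq : 1 ≤ budgetRatio c B := (one_le_div hκ).2 ((hκc v₀).trans (hcB v₀))
    have hK : 1 ≤ Kt := by
      simpa using hKt {v₀} (by simpa [Feasible, cost] using hcB v₀)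
    have hn' : (1 : ℝ) ≤ (n : ℝ) ^ 5 := one_le_pow₀ (by exact_mod_cast hn)
    have hm' : (1 : ℝ) ≤ m := by exact_mod_cast hm
    have hT2' : (2 : ℝ) ≤ T := by exact_mod_cast hT2
    have hT' : (n : ℝ) ^ 5 * m ≤ T := by exact_mod_cast hT
    have hL : 1 / 2 ≤ Real.log T := by
      have := Real.log_le_log (by norm_num) hT2'
      linarith [Real.log_two_gt_d9]
    set q := budgetRatio c B with hqdef
    set L := Real.log T with hLdef
    set δ := 4 + 2 * Kt + 2 * q with hδ
    set N : ℝ := (n : ℝ) ^ 5 with hN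
    have hδ0 : 0 < δ := by linarith
    have hL0 : 0 < L := by linarith
    have hT0 : (0 : ℝ) < T := by linarith
    have hm0 : (0 : ℝ) < m := by linarith
    have hN0 : 0 < N := by linarith
    have cube : ∀ x : ℝ, 0 ≤ x → ∀ a : ℝ, (x ^ (a / 3)) ^ 3 = x ^ a := fun x hx a => by
      rw [← Real.rpow_natCast, ← Real.rpow_mul hx]
      congr 1
      push_cast
      ring
    set y : ℝ := (δ * √L * (T * m / N)) ^ (2 / 3 : ℝ) with hy
    have hbase : 0 < δ * √L * (T * m / N) := by positivity
    have hy0 : 0 < y := Real.rpow_pos_of_pos hbase _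
    have hy3 : y ^ 3 = δ ^ 2 * L * T ^ 2 * m ^ 2 / N ^ 2 := by
      rw [hy, cube _ hbase.le, Real.rpow_two, mul_pow, mul_pow, Real.sq_sqrt hL0.le]
      ring
    have hreps : CMAMAB.reps par m T = ⌈y / m⌉₊ := by
      subst hpar
      have e1 : (1 : ℝ) / (0 + 1) = 1 := by norm_num
      have e2 : (2 + 2 * (0 : ℝ)) / (3 + 0) = 2 / 3 := by norm_num
      change ⌈(m : ℝ)⁻¹ * (δ * √L * (T * m / N) ^ ((1 : ℝ) / (0 + 1)))
        ^ ((2 + 2 * (0 : ℝ)) / (3 + 0))⌉₊ = ⌈y / m⌉₊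
      rw [e1, e2, Real.rpow_one, div_eq_inv_mul y]
    set X : ℝ := (m : ℝ) ^ (-(1 / 3) : ℝ) * Kt ^ (2 / 3 : ℝ) * q ^ (2 / 3 : ℝ)
                * (n : ℝ) ^ (5 / 3 : ℝ) * (T : ℝ) ^ (2 / 3 : ℝ) * L ^ (1 / 3 : ℝ) with hX
    have hX0 : 0 ≤ X := by positivity
    have hX3 : X ^ 3 = Kt ^ 2 * q ^ 2 * N * T ^ 2 * L / m := by
      have e1 : ((m : ℝ) ^ (-(1 / 3) : ℝ)) ^ 3 = (m : ℝ)⁻¹ := by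
        rw [← neg_div, cube _ hm0.le, Real.rpow_neg_one]
      have e5 : ((n : ℝ) ^ (5 / 3 : ℝ)) ^ 3 = N := by
        rw [cube _ (Nat.cast_nonneg n), hN]
        exact_mod_cast Real.rpow_natCast (n : ℝ) 5
      simp only [hX, mul_pow]
      rw [e1, e5, cube _ (by linarith), cube _ (by linarith), cube _ hT0.le, cube _ hL0.le]
      simp only [Real.rpow_two, Real.rpow_one]
      ring
    set r := CMAMAB.reps par m T with hr
    have hr1 : 1 ≤ r := by
      rw [hreps]
      exact Nat.one_le_iff_ne_zero.2 (Nat.ceil_pos.2 (by positivity)).ne'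
    have hrl : y / m ≤ r := by rw [hreps]; exact Nat.le_ceil _
    have hru : (r : ℝ) ≤ y / m + 1 := by
      rw [hreps]; exact (Nat.ceil_lt_add_one (by positivity)).le
    have hr0 : (0 : ℝ) < r := by exact_mod_cast hr1
    have hbal := balance_exploration hn' hm' hT' hK hq hL hδ hX0 hX3 hy0 hy3 hrl hru
    refine integral_regret_le_of_forall hn hB hF hsel par T hα Sopt i fun s hs => ?_
    have h := integral_regret_le hn hc0 hcB hmono hsub hκ hκc hKt hopt.1 hF hm hs par T hr1
      (ρ := √(L / (m * r))) (Real.sqrt_nonneg _) i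
    refine h.trans (le_trans ?_ hbal)
    -- with this accuracy, an estimate fails with probability at most `2 / T ^ 2`
    have hexp : Real.exp (-(2 * (m * r) * √(L / (m * r)) ^ 2)) = 1 / T ^ 2 := by
      rw [Real.sq_sqrt (by positivity)]
      have : -(2 * (m * r) * (L / (m * r))) = -(2 * L) := by field_simp
      rw [this, Real.exp_neg, one_div, two_mul, Real.exp_add, hLdef, Real.exp_log hT0, sq]
    rw [hexp]
    have hle : (2 + 2 * Kt + 2 * (B / ⨅ v, c v)) * √(L / (m * r)) ≤ δ * √(L / (m * r)) :=
      mul_le_mul_of_nonneg_right (by rw [hδ, hqdef, budgetRatio]; linarith) (Real.sqrt_nonneg _)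
    have h8 : 4 * (n : ℝ) ^ 5 * (2 * (1 / (T : ℝ) ^ 2)) = 8 * N / T ^ 2 := by rw [hN]; ring
    rw [h8]
    have := mul_le_mul_of_nonneg_left hle hT0.le
    linarith
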